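/- Let $D$ be a Prüfer domain with quotient field $K$, that is, an integral domain such that $D_P$ is a valuation domain for every prime ideal $P$. The inverse topology on $\mathrm{Spec}(D)$ is the topology generated by the sets $\mathrm{V}(J)=\{P : J\subseteq P\}$ with $J$ a finitely generated ideal. Let $X\subseteq\mathrm{Max}(D)$ be a discrete splitting set, i.e. $X$ is closed under specialization, open in $\mathrm{Spec}(D)$ for the inverse topology, and $P\neq P^2$ for every $P\in X$. For a fractional ideal $I$ let $\mathrm{supp}(I)=\{P\in\mathrm{Spec}(D) : ID_P\neq D_P\}$, and let $\mathrm{Inv}_X(D)$ be the set of invertible fractional ideals $I$ of $D$ with $\mathrm{supp}(I)\subseteq X$. A maximal ideal $M\in X$ is critical with respect to $X$ if no radical ideal $I\in\mathrm{Inv}_X(D)$ satisfies $I\subseteq M$; let $\mathrm{Crit}_X(D)$ be the set of these $M$. For $P\in X$ put $Q=\bigcap_{n\ge 1}P^n$; then $Q$ is a prime ideal, and $D_P/QD_P$ is a discrete valuation ring with quotient field $D_Q/QD_Q$ and normalized valuation $v'_P$. A fractional ideal $I$ is evaluable on $X$ if $QD_P\subsetneq ID_P\subsetneq D_Q$ for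 every $P\in X$; its ideal function is then $\nu_I:X\to\mathbb{Z}$, $\nu_I(P)=v'_P(ID_P/QD_P)$, the least value of a nonzero element of $ID_P/QD_P$. Continuity of $\nu_I$ refers to the topology induced on $X$ by the inverse topology and to the discrete topology of $\mathbb{Z}$. (1) Every $I\in\mathrm{Inv}_X(D)$ is evaluable on $X$ (so that $\nu_I$ is defined). (2) For every proper ideal $I$ of $D$ that belongs to $\mathrm{Inv}_X(D)$, the following are equivalent: (i) $\mathrm{V}(I)\cap\mathrm{Crit}_X(D)=\emptyset$; (ii) $\mathrm{rad}(I)$ is finitely generated; (iii) there are finitely generated radical ideals $J_1,\dots,J_n$ of $D$ such that $I=J_1\cdots J_n$; (iv) $\nu_I$ is continuous. (3) The following are equivalent: (i) $\mathrm{Crit}_X(D)=\emptyset$; (ii) $\mathrm{rad}(I)$ is finitely generated for every proper ideal $I\in\mathrm{Inv}_X(D)$; (iii) every proper ideal $I\in\mathrm{Inv}_X(D)$ is a finite product of finitely generated radical ideals; (iv) $\nu_I$ is continuous for every $I\in\mathrm{Inv}_X(D)$. -/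

import Mathlib

open scoped nonZeroDivisors

/-- A Prüfer domain: an integral domain all of whose localizations at prime ideals are
valuation domains. -/
class IsPruferDomain (D : Type*) [CommRing D] [IsDomain D] : Prop where
  valuationRing_localization : ∀ (P : Ideal D) [P.IsPrime],
    ValuationRing (Localization.AtPrime P)

section Topology

variable (R : Type*) [CommRing R]

/-- The inverse topology on `Spec R`: it is generated by the sets `V(I)`, with `I` a finitely
generated ideal. -/
@[reducible] def inverseTopology : TopologicalSpace (PrimeSpectrum R) :=
  TopologicalSpace.generateFrom
    {U | ∃ I : Ideal R, I.FG ∧ U = PrimeSpectrum.zeroLocus (I : Set R)}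

variable {R}

/-- A splitting set (of a Prüfer domain): a subset of the spectrum that is closed under
specialization and open in the inverse topology. -/
structure IsSplittingSet (X : Set (PrimeSpectrum R)) : Prop where
  upward_closed : ∀ P ∈ X, ∀ Q : PrimeSpectrum R, P ≤ Q → Q ∈ X
  isOpen_inverse : @IsOpen _ (inverseTopology R) X

/-- A splitting set is discrete if it contains no idempotent prime ideal. -/
structure IsDiscreteSplittingSet (X : Set (PrimeSpectrum R)) : Prop extends IsSplittingSet X where
  not_idempotent : ∀ P ∈ X, P.asIdeal ^ 2 ≠ P.asIdeal

/-- For an ideal `P`, the ideal `⋂ n, P ^ n` (the exponent `0` contributes only the whole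
ring). -/
def powInf (P : Ideal R) : Ideal R := ⨅ n : ℕ, P ^ n

end Topology

section ValuationRing

/-! ### Auxiliary facts on valuation rings with non-idempotent maximal ideal -/

variable {A : Type*} [CommRing A] [IsDomain A] [ValuationRing A]

theorem exists_maximalIdeal_eq_span
    (h : IsLocalRing.maximalIdeal A ^ 2 ≠ IsLocalRing.maximalIdeal A) :
    ∃ t : A, t ≠ 0 ∧ IsLocalRing.maximalIdeal A = Ideal.span {t} := by
  have hlt : IsLocalRing.maximalIdeal A ^ 2 < IsLocalRing.maximalIdeal A :=
    lt_of_le_of_ne (Ideal.pow_le_self two_ne_zero) h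
  obtain ⟨t, htm, ht2⟩ := SetLike.exists_of_lt hlt
  refine ⟨t, fun h0 => ht2 (by rw [h0]; exact zero_mem _), le_antisymm (fun x hx => ?_) ?_⟩
  · rw [Ideal.mem_span_singleton]
    obtain ⟨c, hc | hc⟩ := ValuationRing.cond x t
    · have hu : IsUnit c := by
        by_contra hcu
        exact ht2 (by
          rw [← hc, pow_two]
          exact Ideal.mul_mem_mul hx ((IsLocalRing.mem_maximalIdeal c).2 hcu))
      obtain ⟨u, rfl⟩ := hu
      exact ⟨((u⁻¹ : Aˣ) : A), by rw [← hc, mul_assoc, Units.mul_inv, mul_one]⟩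
    · exact ⟨c, hc.symm⟩
  · rw [Ideal.span_singleton_le_iff_mem]
    exact htm

theorem exists_eq_unit_mul_pow {t : A} (ht : IsLocalRing.maximalIdeal A = Ideal.span {t})
    {x : A} (hx : x ∉ powInf (IsLocalRing.maximalIdeal A)) :
    ∃ (u : Aˣ) (n : ℕ), x = u * t ^ n := by
  classical
  have hex : ∃ n, ¬ t ^ n ∣ x := by
    by_contra! hcon
    refine hx ?_
    rw [powInf, Submodule.mem_iInf]
    intro n
    rw [ht, Ideal.span_singleton_pow, Ideal.mem_span_singleton]
    exact hcon n
  obtain ⟨k, hk⟩ : ∃ k, Nat.find hex = k + 1 :=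
    Nat.exists_eq_succ_of_ne_zero (fun h0 => Nat.find_spec hex (by rw [h0]; simp))
  have h1 : t ^ k ∣ x := not_not.1 (Nat.find_min hex (m := k) (by omega))
  have h2 : ¬ t ^ (k + 1) ∣ x := hk ▸ Nat.find_spec hex
  obtain ⟨c, rfl⟩ := h1
  have hc : IsUnit c := by
    by_contra hcu
    have : c ∈ Ideal.span {t} := ht ▸ (IsLocalRing.mem_maximalIdeal c).2 hcu
    obtain ⟨d, rfl⟩ := Ideal.mem_span_singleton.1 this
    exact h2 ⟨d, by ring⟩
  obtain ⟨u, rfl⟩ := hc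
  exact ⟨u, k, mul_comm _ _⟩

theorem unit_mul_pow_notMem_powInf {t : A} (h0 : t ≠ 0)
    (ht : IsLocalRing.maximalIdeal A = Ideal.span {t}) (u : Aˣ) (n : ℕ) :
    (u : A) * t ^ n ∉ powInf (IsLocalRing.maximalIdeal A) := by
  intro h
  rw [powInf, Submodule.mem_iInf] at h
  have h1 := h (n + 1)
  rw [ht, Ideal.span_singleton_pow, Ideal.mem_span_singleton] at h1
  have h2 : t ^ (n + 1) ∣ t ^ n := (Units.dvd_mul_left).1 h1
  have h3 : IsUnit t := by
    obtain ⟨c, hc⟩ := h2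
    have : t ^ n * 1 = t ^ n * (t * c) := by rw [mul_one, ← mul_assoc, ← pow_succ]; exact hc
    exact IsUnit.of_mul_eq_one c (mul_left_cancel₀ (pow_ne_zero n h0) this).symm
  have h4 : t ∈ IsLocalRing.maximalIdeal A := ht ▸ Ideal.mem_span_singleton_self t
  exact (IsLocalRing.mem_maximalIdeal t).1 h4 h3

theorem powInf_maximalIdeal_isPrime
    (h : IsLocalRing.maximalIdeal A ^ 2 ≠ IsLocalRing.maximalIdeal A) :
    (powInf (IsLocalRing.maximalIdeal A)).IsPrime := by
  obtain ⟨t, h0, ht⟩ := exists_maximalIdeal_eq_span h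
  refine ⟨fun htop => ?_, fun {x y} hxy => ?_⟩
  · exact unit_mul_pow_notMem_powInf h0 ht 1 0 (htop ▸ Submodule.mem_top)
  · by_contra! hcon
    obtain ⟨u, n, rfl⟩ := exists_eq_unit_mul_pow ht hcon.1
    obtain ⟨v, m, rfl⟩ := exists_eq_unit_mul_pow ht hcon.2
    refine unit_mul_pow_notMem_powInf h0 ht (u * v) (n + m) ?_
    convert! hxy using 1
    push_cast
    ring

theorem quotient_powInf_isDiscreteValuationRing
    (h : IsLocalRing.maximalIdeal A ^ 2 ≠ IsLocalRing.maximalIdeal A)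
    [IsDomain (A ⧸ powInf (IsLocalRing.maximalIdeal A))] :
    IsDiscreteValuationRing (A ⧸ powInf (IsLocalRing.maximalIdeal A)) := by
  obtain ⟨t, h0, ht⟩ := exists_maximalIdeal_eq_span h
  have htm : t ∈ IsLocalRing.maximalIdeal A := ht ▸ Ideal.mem_span_singleton_self t
  have hle : powInf (IsLocalRing.maximalIdeal A) ≤ IsLocalRing.maximalIdeal A :=
    (iInf_le _ 1).trans (by rw [pow_one])
  have hunit : ∀ a : A, ¬ IsUnit (Ideal.Quotient.mk (powInf (IsLocalRing.maximalIdeal A)) a) →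
      t ∣ a := by
    intro a ha
    rw [← Ideal.mem_span_singleton, ← ht]
    exact (IsLocalRing.mem_maximalIdeal a).2 fun hu => ha (hu.map _)
  apply IsDiscreteValuationRing.ofHasUnitMulPowIrreducibleFactorization
  refine ⟨Ideal.Quotient.mk _ t, ⟨fun hu => ?_, fun {a b} hab => ?_⟩, fun {x} hx => ?_⟩
  · obtain ⟨c, hc⟩ := hu.exists_right_inv
    obtain ⟨c, rfl⟩ := Ideal.Quotient.mk_surjective c
    rw [← map_mul, ← map_one (Ideal.Quotient.mk _), Ideal.Quotient.eq] at hc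
    have h1 : (1 : A) ∈ IsLocalRing.maximalIdeal A := by
      have h2 := sub_mem (Ideal.mul_mem_right c _ htm) (hle hc)
      simp only [sub_sub_cancel] at h2
      exact h2
    exact (IsLocalRing.mem_maximalIdeal (1 : A)).1 h1 isUnit_one
  · by_contra! hcon
    obtain ⟨a, rfl⟩ := Ideal.Quotient.mk_surjective a
    obtain ⟨b, rfl⟩ := Ideal.Quotient.mk_surjective b
    obtain ⟨c, rfl⟩ := hunit a hcon.1
    obtain ⟨d, rfl⟩ := hunit b hcon.2
    rw [← map_mul, Ideal.Quotient.eq] at hab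
    have hu : IsUnit (1 - t * (c * d)) := by
      have hm : t * (c * d) ∈ IsLocalRing.maximalIdeal A := Ideal.mul_mem_right _ _ htm
      exact IsLocalRing.isUnit_one_sub_self_of_mem_nonunits _
        ((IsLocalRing.mem_maximalIdeal _).1 hm)
    obtain ⟨u, hu⟩ := hu
    refine unit_mul_pow_notMem_powInf h0 ht u 1 ?_
    rw [hu]
    convert! hab using 1
    ring
  · obtain ⟨x, rfl⟩ := Ideal.Quotient.mk_surjective x
    obtain ⟨u, n, rfl⟩ := exists_eq_unit_mul_pow ht
      (fun hm => hx (Ideal.Quotient.eq_zero_iff_mem.2 hm))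
    refine ⟨n, (Units.map (Ideal.Quotient.mk
      (powInf (IsLocalRing.maximalIdeal A))).toMonoidHom u), ?_⟩
    rw [map_mul, map_pow, mul_comm]
    rfl

end ValuationRing

section Local

variable {D : Type*} [CommRing D] [IsDomain D]
variable (K : Type*) [Field K] [Algebra D K] [IsFractionRing D K]

/-- The localization `D_P`, as a subring of the quotient field `K` of `D`. -/
noncomputable abbrev localizationIn (P : Ideal D) [P.IsPrime] : Subalgebra D K :=
  Localization.subalgebra.ofField K P.primeCompl P.primeCompl_le_nonZeroDivisors

variable {K} in
/-- The extension `I D_P` of a fractional ideal `I` to `D_P`, as a `D`-submodule of `K`. -/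
noncomputable def extendAt (I : FractionalIdeal D⁰ K) (P : Ideal D) [P.IsPrime] :
    Submodule D K :=
  (I : Submodule D K) * Subalgebra.toSubmodule (localizationIn K P)

variable {K} in
/-- The support of a fractional ideal: the set of all primes `P` with `I D_P ≠ D_P`. -/
def fracSupport (I : FractionalIdeal D⁰ K) : Set (PrimeSpectrum D) :=
  {P | extendAt I P.asIdeal ≠ Subalgebra.toSubmodule (localizationIn K P.asIdeal)}

/-- `Inv_X(D)`: the invertible fractional ideals with support contained in `X`. -/
def InvOn (X : Set (PrimeSpectrum D)) : Set (FractionalIdeal D⁰ K) :=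
  {I | IsUnit I ∧ fracSupport I ⊆ X}

/-- `Crit_X(D)`: the `M ∈ X` such that no radical ideal in `Inv_X(D)` is contained in `M`. -/
def criticalSet (X : Set (PrimeSpectrum D)) : Set (PrimeSpectrum D) :=
  {M | M ∈ X ∧ ¬ ∃ J : Ideal D, J.IsRadical ∧ (J : FractionalIdeal D⁰ K) ∈ InvOn K X ∧
    J ≤ M.asIdeal}

variable {K} in
/-- A fractional ideal `I` is evaluable on a set `X` of (maximal) ideals if
`Q D_P ⊊ I D_P ⊊ D_Q` for all `P ∈ X`, where `Q = ⋂ n, P ^ n`. For `P` maximal and not idempotent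
in a Prüfer domain, `Q` is automatically prime. -/
def IsEvaluableOn (I : FractionalIdeal D⁰ K) (X : Set (PrimeSpectrum D)) : Prop :=
  ∀ P ∈ X, ∃ _ : (powInf P.asIdeal).IsPrime,
    extendAt (powInf P.asIdeal : FractionalIdeal D⁰ K) P.asIdeal < extendAt I P.asIdeal ∧
    extendAt I P.asIdeal < Subalgebra.toSubmodule (localizationIn K (powInf P.asIdeal))

/-- The ring `D_P / Q D_P`, where `Q = ⋂ n, P ^ n`. -/
abbrev ResidueRing (P : Ideal D) [P.IsPrime] : Type _ :=
  localizationIn K P ⧸ (powInf P).map (algebraMap D (localizationIn K P))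

instance localizationIn_isLocalRing (P : Ideal D) [P.IsPrime] :
    IsLocalRing (localizationIn K P) :=
  IsLocalization.AtPrime.isLocalRing (localizationIn K P) P

instance localizationIn_valuationRing [IsPruferDomain D] (P : Ideal D) [P.IsPrime] :
    ValuationRing (localizationIn K P) := by
  have := IsPruferDomain.valuationRing_localization P
  exact Function.Surjective.valuationRing
    (IsLocalization.algEquiv P.primeCompl (Localization.AtPrime P)
      (localizationIn K P)).toRingEquiv.toRingHom
    (IsLocalization.algEquiv P.primeCompl (Localization.AtPrime P)
      (localizationIn K P)).surjective

variable (P : Ideal D) [P.IsMaximal]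

theorem map_powInf :
    (powInf P).map (algebraMap D (localizationIn K P)) =
      powInf (IsLocalRing.maximalIdeal (localizationIn K P)) := by
  apply le_antisymm
  · refine le_iInf fun n => ?_
    rw [← IsLocalization.AtPrime.map_eq_maximalIdeal P (localizationIn K P), ← Ideal.map_pow]
    exact Ideal.map_mono (iInf_le _ n)
  · rw [← IsLocalization.map_under P.primeCompl (localizationIn K P)
      (powInf (IsLocalRing.maximalIdeal (localizationIn K P)))]
    refine Ideal.map_mono (le_iInf fun n => ?_)
    rw [← IsLocalization.AtPrime.under_maximalIdeal_pow P (localizationIn K P) n]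
    exact Ideal.comap_mono (iInf_le _ n)

variable {P} in
theorem maximalIdeal_not_idempotent (hP : P ^ 2 ≠ P) :
    IsLocalRing.maximalIdeal (localizationIn K P) ^ 2 ≠
      IsLocalRing.maximalIdeal (localizationIn K P) := by
  intro h
  apply hP
  rw [← IsLocalization.AtPrime.under_maximalIdeal_pow P (localizationIn K P) 2, h,
    IsLocalization.AtPrime.under_maximalIdeal (localizationIn K P) P]

variable {P}
variable [IsPruferDomain D]

theorem residueRing_isDomain (hP : P ^ 2 ≠ P) : IsDomain (ResidueRing K P) := by
  have : ((powInf P).map (algebraMap D (localizationIn K P))).IsPrime := by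
    rw [map_powInf]
    exact powInf_maximalIdeal_isPrime (maximalIdeal_not_idempotent K hP)
  exact Ideal.Quotient.isDomain _

/-- If `P` is a non-idempotent maximal ideal of a Prüfer domain, `D_P / Q D_P` is a discrete
valuation ring. -/
theorem residueRing_isDiscreteValuationRing (hP : P ^ 2 ≠ P) [IsDomain (ResidueRing K P)] :
    IsDiscreteValuationRing (ResidueRing K P) := by
  have hprime := powInf_maximalIdeal_isPrime (maximalIdeal_not_idempotent K hP)
  have : IsDomain (localizationIn K P ⧸ powInf (IsLocalRing.maximalIdeal (localizationIn K P))) :=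
    Ideal.Quotient.isDomain _
  have := quotient_powInf_isDiscreteValuationRing (maximalIdeal_not_idempotent K hP)
  exact IsDiscreteValuationRing.RingEquivClass.isDiscreteValuationRing
    (Ideal.quotEquivOfEq (map_powInf K P).symm)

variable {K}

/-- The normalized valuation `v'_P` of the discrete valuation ring `D_P / Q D_P`, as a function
on elements of `D_P` (with values in `ℕ∞`, the elements of `Q D_P` having value `⊤`). -/
noncomputable def residueVal (hP : P ^ 2 ≠ P) (a : localizationIn K P) : ℕ∞ :=
  haveI := residueRing_isDomain K hP
  haveI := residueRing_isDiscreteValuationRing K hP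
  IsDiscreteValuationRing.addVal (ResidueRing K P) (Ideal.Quotient.mk _ a)

/-- `w_P(I) = v'_P(I D_P / Q D_P)`, the least value of a nonzero element of `I D_P / Q D_P`.
Nonzero elements of the quotient field `D_Q / Q D_Q` of `D_P / Q D_P` are the classes of the
fractions `a / b` with `a, b ∈ D_P` not in `Q D_P`, and such a class has value
`v'_P(a) - v'_P(b)`. -/
noncomputable def localValue (hP : P ^ 2 ≠ P) (I : FractionalIdeal D⁰ K) : ℤ :=
  sInf {n : ℤ | ∃ a b : localizationIn K P, residueVal hP a ≠ ⊤ ∧ residueVal hP b ≠ ⊤ ∧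
    (a : K) / (b : K) ∈ extendAt I P ∧
    n = ((residueVal hP a).toNat : ℤ) - ((residueVal hP b).toNat : ℤ)}

/-- The ideal function `ν_I : X → ℤ`, `P ↦ w_P(I)`, for a discrete splitting set `X` of maximal
ideals. -/
noncomputable def idealFunction {X : Set (PrimeSpectrum D)} (hX : IsDiscreteSplittingSet X)
    (hmax : ∀ P ∈ X, P.asIdeal.IsMaximal) (I : FractionalIdeal D⁰ K) : X → ℤ :=
  fun P =>
    haveI := hmax P.1 P.2
    localValue (hX.not_idempotent P.1 P.2) I

/-- Continuity of a function `X → ℤ` for the topology induced on `X` by the inverse topology of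
the spectrum and the discrete topology of `ℤ`. -/
def InverseContinuous {X : Set (PrimeSpectrum D)} (f : X → ℤ) : Prop :=
  @Continuous X ℤ (TopologicalSpace.induced Subtype.val (inverseTopology D)) ⊥ f

end Local

/-- `I` is a finite product of finitely generated radical ideals. -/
def HasRadicalFactorization {D : Type*} [CommRing D] (I : Ideal D) : Prop :=
  ∃ (n : ℕ) (J : Fin n → Ideal D), (∀ i, (J i).FG ∧ (J i).IsRadical) ∧ I = ∏ i, J i

/-!
Everything is reduced to elementary statements about elements outside a prime. For `P ∈ X`, an
element `t` of `P` outside `P ^ 2` generates `P D_P` (`exists_mul_eq_mul_pow`), and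
`Q = ⋂ n, P ^ n` is a prime outside `X`. Hence an ideal `I ∈ Inv_X(D)` satisfies `I D_Q = D_Q`, and
a generator of `I D_P` is a unit of `D_Q`, so that `I D_P = t ^ n D_P` for some integer `n`
(`exists_zpow_isLocalGenerator`). This gives evaluability, and `ν_I(P) = n`
(`IsLocalGenerator.localValue_eq`).

The notion that links the conditions of the theorem is that of a local uniformizer at `M ∈ X`: an
element `t` that generates `P D_P` for every `P ∈ X` near `M` in the inverse topology. Its existence
is equivalent to `M` not being critical (`notMem_criticalSet_iff`), since a finitely generated ideal
`B` with `V(B) ⊆ X` is radical exactly if `B ⊄ P ^ 2` for all `P ∈ V(B)`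
(`Ideal.IsRadical.not_le_sq`, `Ideal.isRadical_of_forall_not_le_sq`).

Let `I` be an integral ideal in `Inv_X(D)`.

* If all points of `V(I)` have local uniformizers, these can be multiplied into the radical of `I`,
  and by compactness of the constructible topology finitely many of them generate the radical
  together with `I` (`radical_fg_of_hasLocalUniformizer`).
* If moreover the radical `R` of `I` is finitely generated, `ν_I` is bounded, because a power of `R`
  lies in `I`; the ideal `I R⁻¹` has smaller values and its locus lies in `V(I)`, so induction on
  the bound yields a factorization into radical ideals
  (`hasRadicalFactorization_of_hasLocalUniformizer`).
* With a local uniformizer `t` at `M`, an equality `I D_M = t ^ n D_M` persists near `M`, whence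
  `ν_I` is locally constant there (`HasLocalUniformizer.idealFunction_eventually_eq`); off `V(I)` it
  vanishes, and `V(I)` is closed in `X`.
* If `ν_I` has the constant value `n > 0` near `M` and `t` generates `M D_M`, then
  `I D_P = t ^ n D_P` near `M` forces `t` to have value `1` at `P`, so `t` is a local uniformizer
  at `M` (`hasLocalUniformizer_of_inverseContinuous`).

For the global statement, each `M ∈ X` contains a finitely generated ideal `A` with `V(A) ⊆ X`, as
`X` is open, and then `A ∈ Inv_X(D)`.
-/

/-! ### Maximal ideals, radicals and quasi-compactness of the inverse topology -/

section Ideals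

variable {D : Type*} [CommRing D]

theorem Ideal.IsMaximal.exists_one_sub_mul_mem {P : Ideal D} (hP : P.IsMaximal) {s : D}
    (hs : s ∉ P) : ∃ r, 1 - r * s ∈ P := by
  obtain ⟨r, y, hy, h⟩ := hP.exists_inv hs
  exact ⟨r, by rwa [← h, add_sub_cancel_left]⟩

theorem Ideal.IsPrime.notMem_of_one_sub_mul_mem {P : Ideal D} (hP : P.IsPrime) {r s : D}
    (h : 1 - r * s ∈ P) : s ∉ P := fun hs =>
  hP.ne_top ((Ideal.eq_top_iff_one P).2 (by simpa using add_mem h (P.mul_mem_left r hs)))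

theorem Ideal.IsMaximal.mem_pow_of_mul_mem {P : Ideal D} (hP : P.IsMaximal) {n : ℕ} {s x : D}
    (hs : s ∉ P) (h : s * x ∈ P ^ n) : x ∈ P ^ n := by
  have htop : Ideal.span {s} ⊔ P = ⊤ := by
    obtain ⟨r, i, hi, h1⟩ := hP.exists_inv hs
    rw [Ideal.eq_top_iff_one, ← h1]
    exact Submodule.add_mem_sup (Ideal.mul_mem_left _ r (Ideal.mem_span_singleton_self s)) hi
  have h1 : Ideal.span {s} ⊔ P ^ n = ⊤ := Ideal.sup_pow_eq_top htop
  obtain ⟨a, ha, b, hb, hab⟩ := Submodule.mem_sup.1 ((Ideal.eq_top_iff_one _).1 h1)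
  obtain ⟨c, rfl⟩ := Ideal.mem_span_singleton'.1 ha
  have : x = c * (s * x) + x * b := by linear_combination (-x) * hab
  rw [this]
  exact add_mem (Ideal.mul_mem_left _ _ h) (Ideal.mul_mem_left _ _ hb)

/-- If the primes containing `I` are all maximal, then `I` extends to an ideal of `D_M` whose
radical is `M D_M` or the whole ring, for every prime `M`. -/
theorem exists_mul_mem_radical {I M : Ideal D} (hM : M.IsPrime)
    (hI : ∀ P : PrimeSpectrum D, I ≤ P.asIdeal → P.asIdeal.IsMaximal) {t : D} (ht : t ∈ M) :
    ∃ s ∉ M, s * t ∈ I.radical := by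
  by_cases hdis : Disjoint (I : Set D) ((Submonoid.powers t ⊔ M.primeCompl : Submonoid D) : Set D)
  · obtain ⟨P, hP, hIP, hPd⟩ := Ideal.exists_le_prime_disjoint I _ hdis
    have hPM : P ≤ M := fun x hx => by
      by_contra hxM
      exact Set.disjoint_left.1 hPd hx
        (Submonoid.mem_sup_right (S := Submonoid.powers t) (T := M.primeCompl) hxM)
    have := (hI ⟨P, hP⟩ hIP).eq_of_le hM.ne_top hPM
    subst this
    exact absurd (Submonoid.mem_sup_left (Submonoid.mem_powers t))
      (Set.disjoint_left.1 hPd ht)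
  · obtain ⟨x, hxI, hx⟩ := Set.not_disjoint_iff.1 hdis
    obtain ⟨_, ⟨n, rfl⟩, s, hs, rfl⟩ := Submonoid.mem_sup.1 hx
    refine ⟨s, hs, n + 1, ?_⟩
    have : (s * t) ^ (n + 1) = (s ^ n * t) * (t ^ n * s) := by ring
    rw [this]
    exact I.mul_mem_left _ hxI

/-- Quasi-compactness of a closed set for the inverse topology: a choice of finitely generated
ideals `C M ≤ M`, for `M` in `V(I)`, admits a finite subfamily whose loci cover `V(I)`. -/
theorem exists_finset_cover_zeroLocus (I : Ideal D) (C : PrimeSpectrum D → Ideal D)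
    (hfg : ∀ M, (C M).FG) (hC : ∀ M, I ≤ M.asIdeal → C M ≤ M.asIdeal) :
    ∃ S : Finset (PrimeSpectrum D), ∀ P : PrimeSpectrum D, I ≤ P.asIdeal →
      ∃ M ∈ S, I ≤ M.asIdeal ∧ C M ≤ P.asIdeal := by
  -- `V(J)` is the complement of a quasi-compact open set when `J` is finitely generated, hence
  -- clopen in the constructible topology, which is compact.
  have hclopen : ∀ J : Ideal D, J.FG → IsClopen
      (WithTopology.ofTopology (t := constructibleTopology (PrimeSpectrum D)) ⁻¹'
        PrimeSpectrum.zeroLocus (J : Set D)) := by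
    intro J hJ
    obtain ⟨hc, ho⟩ := PrimeSpectrum.isCompact_isOpen_iff_ideal.2 ⟨J, hJ, rfl⟩
    refine ⟨isOpen_compl_iff.1 ?_, ?_⟩
    · exact WithConstructibleTopology.isOpen_iff.2 (hc.isOpen_constructibleTopology_of_isOpen ho)
    · exact WithConstructibleTopology.isOpen_iff.2
        (IsCompact.isOpen_constructibleTopology_of_isClosed hc
          (PrimeSpectrum.isClosed_zeroLocus _))
  have hclosed : IsClosed
      (WithTopology.ofTopology (t := constructibleTopology (PrimeSpectrum D)) ⁻¹'
        PrimeSpectrum.zeroLocus (I : Set D)) := by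
    have : PrimeSpectrum.zeroLocus (I : Set D) =
        ⋂ x : I, PrimeSpectrum.zeroLocus (Ideal.span {(x : D)} : Set D) := by
      ext P
      simp [Set.subset_def, PrimeSpectrum.mem_zeroLocus]
    rw [this, Set.preimage_iInter]
    exact isClosed_iInter fun x => (hclopen _ (Submodule.fg_span_singleton _)).1
  obtain ⟨S, hS⟩ := hclosed.isCompact.elim_finite_subcover
    (fun M : {M : PrimeSpectrum D // I ≤ M.asIdeal} => WithTopology.ofTopology ⁻¹'
      PrimeSpectrum.zeroLocus (C M.1 : Set D)) (fun M => (hclopen _ (hfg M.1)).2)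
    (fun P hP => Set.mem_iUnion.2 ⟨⟨P.ofTopology, hP⟩, hC P.ofTopology hP⟩)
  classical
  refine ⟨S.image Subtype.val, fun P hP => ?_⟩
  obtain ⟨M, hM, hPM⟩ := Set.mem_iUnion₂.1 (hS (a := WithTopology.toTopology _ P) hP)
  exact ⟨M.1, Finset.mem_image_of_mem _ hM, M.2, hPM⟩

end Ideals

/-! ### Prüfer domains: local generators and invertible ideals -/

section Prufer

variable {D : Type*} [CommRing D] [IsDomain D] [IsPruferDomain D]

theorem IsPruferDomain.exists_mul_eq_or (P : Ideal D) [P.IsPrime] (a b : D) :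
    ∃ s ∉ P, ∃ c, s * a = c * b ∨ s * b = c * a := by
  have := IsPruferDomain.valuationRing_localization P
  have key : ∀ a b : D, algebraMap D (Localization.AtPrime P) b ∣ algebraMap D _ a →
      ∃ s ∉ P, ∃ c, s * a = c * b := by
    rintro a b ⟨c, hc⟩
    obtain ⟨⟨c, s⟩, h⟩ := IsLocalization.surj P.primeCompl c
    refine ⟨s, s.2, c, IsLocalization.injective (Localization.AtPrime P)
      P.primeCompl_le_nonZeroDivisors ?_⟩
    simp only at h
    rw [map_mul, map_mul, hc, ← h]
    ring
  obtain h | h := ValuationRing.dvd_total (algebraMap D (Localization.AtPrime P) b)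
    (algebraMap D _ a)
  · obtain ⟨s, hs, c, h⟩ := key a b h
    exact ⟨s, hs, c, Or.inl h⟩
  · obtain ⟨s, hs, c, h⟩ := key b a h
    exact ⟨s, hs, c, Or.inr h⟩

/-- An element of `P` outside `P ^ 2` generates the powers of `P` locally at `P`. -/
theorem exists_mul_eq_mul_pow {P : Ideal D} (hP : P.IsMaximal) {t : D} (ht2 : t ∉ P ^ 2)
    (n : ℕ) {x : D} (hx : x ∈ P ^ n) : ∃ s ∉ P, ∃ c, s * x = c * t ^ n := by
  have := hP.isPrime
  induction n generalizing x with
  | zero => exact ⟨1, hP.isPrime.one_notMem, x, by ring⟩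
  | succ n ih =>
    rw [pow_succ] at hx
    induction hx using Submodule.mul_induction_on' with
    | mem_mul_mem x hx y hy =>
      obtain ⟨s, hs, c, h⟩ := ih hx
      obtain ⟨s', hs', c', h' | h'⟩ := IsPruferDomain.exists_mul_eq_or P y t
      · exact ⟨s * s', fun h => (hP.isPrime.mem_or_mem h).elim hs hs', c * c',
          by linear_combination (s' * y) * h + c * t ^ n * h'⟩
      · by_cases hc : c' ∈ P
        · refine absurd (hP.mem_pow_of_mul_mem hs' ?_) ht2
          rw [h', pow_two]
          exact Ideal.mul_mem_mul hc hy
        · exact ⟨s * c', fun h => (hP.isPrime.mem_or_mem h).elim hs hc, c * s',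
            by linear_combination (c' * y) * h - c * t ^ n * h'⟩
    | add x _ y _ hx hy =>
      obtain ⟨s, hs, c, h⟩ := hx
      obtain ⟨s', hs', c', h'⟩ := hy
      exact ⟨s * s', fun h => (hP.isPrime.mem_or_mem h).elim hs hs', s' * c + s * c',
        by linear_combination s' * h + s * h'⟩

theorem le_of_mul_pow_mem {P : Ideal D} (hP : P.IsMaximal) {t : D} (ht : t ∈ P) (ht2 : t ∉ P ^ 2)
    {d : D} (hd : d ∉ P) {k n : ℕ} (h : d * t ^ n ∈ P ^ k) : k ≤ n := by
  by_contra! hlt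
  obtain ⟨s, hs, c, hc⟩ := exists_mul_eq_mul_pow hP ht2 (n + 1) (Ideal.pow_le_pow_right hlt h)
  have ht0 : t ≠ 0 := fun h0 => ht2 (h0 ▸ zero_mem _)
  have : s * d = c * t := mul_right_cancel₀ (pow_ne_zero n ht0) (by rw [mul_assoc, hc]; ring)
  exact (hP.isPrime.mem_or_mem (this ▸ P.mul_mem_left c ht)).elim hs hd

/-- In a Prüfer domain a finitely generated ideal is locally generated by one of its elements. -/
theorem Ideal.FG.exists_local_generator {I : Ideal D} (hI : I.FG) (P : Ideal D) [hP : P.IsPrime] :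
    ∃ a ∈ I, ∃ s ∉ P, ∀ y ∈ I, ∃ c, s * y = c * a := by
  induction I, hI using Submodule.fg_induction with
  | singleton x =>
    refine ⟨x, Ideal.mem_span_singleton_self x, 1, hP.one_notMem, fun y hy => ?_⟩
    obtain ⟨c, rfl⟩ := Ideal.mem_span_singleton'.1 hy
    exact ⟨c, one_mul _⟩
  | sup I J hI hJ ihI ihJ =>
    obtain ⟨a, ha, s, hs, h⟩ := ihI
    obtain ⟨b, hb, s', hs', h'⟩ := ihJ
    obtain ⟨r, hr, c, hc | hc⟩ := IsPruferDomain.exists_mul_eq_or P a b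
    · refine ⟨b, Ideal.mem_sup_right hb, s * s' * r, ?_, fun w hw => ?_⟩
      · simp [hP.mul_mem_iff_mem_or_mem, hs, hs', hr]
      · obtain ⟨y, hy, z, hz, rfl⟩ := Submodule.mem_sup.1 hw
        obtain ⟨d, hd⟩ := h y hy
        obtain ⟨e, he⟩ := h' z hz
        exact ⟨s' * d * c + s * r * e,
          by linear_combination s' * r * hd + s' * d * hc + s * r * he⟩
    · refine ⟨a, Ideal.mem_sup_left ha, s * s' * r, ?_, fun w hw => ?_⟩
      · simp [hP.mul_mem_iff_mem_or_mem, hs, hs', hr]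
      · obtain ⟨y, hy, z, hz, rfl⟩ := Submodule.mem_sup.1 hw
        obtain ⟨d, hd⟩ := h y hy
        obtain ⟨e, he⟩ := h' z hz
        exact ⟨s' * r * d + s * e * c,
          by linear_combination s' * r * hd + s * r * he + s * e * hc⟩

variable (K : Type*) [Field K] [Algebra D K] [IsFractionRing D K]

/-- In a Prüfer domain the nonzero finitely generated ideals are invertible. -/
theorem Ideal.FG.isUnit_coeIdeal {I : Ideal D} (hI : I.FG) (h0 : I ≠ ⊥) :
    IsUnit (I : FractionalIdeal D⁰ K) := by
  have hI0 : (I : FractionalIdeal D⁰ K) ≠ 0 := FractionalIdeal.coeIdeal_ne_zero.2 h0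
  rw [← FractionalIdeal.mul_inv_cancel_iff_isUnit]
  obtain ⟨J, hJ⟩ := FractionalIdeal.le_one_iff_exists_coeIdeal.1
    (FractionalIdeal.mul_one_div_le_one (I := (I : FractionalIdeal D⁰ K)))
  rw [FractionalIdeal.inv_eq, ← hJ]
  suffices h : J = ⊤ by rw [h, FractionalIdeal.coeIdeal_top]
  by_contra hne
  obtain ⟨P, hP, hJP⟩ := Ideal.exists_le_maximal J hne
  have := hP.isPrime
  obtain ⟨a, ha, s, hs, h⟩ := hI.exists_local_generator P
  have hinj := FaithfulSMul.algebraMap_injective D K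
  have ha0 : a ≠ 0 := by
    rintro rfl
    obtain ⟨y, hy, hy0⟩ := Submodule.exists_mem_ne_zero_of_ne_bot h0
    obtain ⟨c, hc⟩ := h y hy
    rw [mul_zero, mul_eq_zero] at hc
    exact hc.elim (fun h => hs (h ▸ zero_mem _)) hy0
  have ha0' : algebraMap D K a ≠ 0 := by simpa using ha0
  refine hs (hJP ?_)
  have hinv : algebraMap D K s / algebraMap D K a ∈ (I : FractionalIdeal D⁰ K)⁻¹ := by
    rw [FractionalIdeal.mem_inv_iff hI0]
    intro z hz
    obtain ⟨y, hy, rfl⟩ := (FractionalIdeal.mem_coeIdeal _).1 hz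
    obtain ⟨c, hc⟩ := h y hy
    refine (FractionalIdeal.mem_one_iff _).2 ⟨c, ?_⟩
    rw [div_mul_eq_mul_div, eq_div_iff ha0', ← map_mul, ← map_mul, hc]
  have := FractionalIdeal.mul_mem_mul (FractionalIdeal.mem_coeIdeal_of_mem D⁰ ha) hinv
  rw [mul_div_cancel₀ _ ha0', FractionalIdeal.inv_eq, ← hJ] at this
  obtain ⟨s', hs', heq⟩ := (FractionalIdeal.mem_coeIdeal _).1 this
  exact hinj heq ▸ hs'

end Prufer

/-! ### Neighbourhoods in the inverse topology -/

section InverseTopology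

variable {R : Type*} [CommRing R]

/-- The sets `V(F)` with `F` finitely generated are a basis, not only a subbasis, of the inverse
topology. -/
theorem exists_fg_of_isOpen_inverseTopology {U : Set (PrimeSpectrum R)}
    (hU : @IsOpen _ (inverseTopology R) U) {M : PrimeSpectrum R} (hM : M ∈ U) :
    ∃ F : Ideal R, F.FG ∧ F ≤ M.asIdeal ∧ ∀ P : PrimeSpectrum R, F ≤ P.asIdeal → P ∈ U := by
  induction hU with
  | basic U hU =>
    obtain ⟨F, hF, rfl⟩ := hU
    exact ⟨F, hF, hM, fun P hP => hP⟩
  | univ => exact ⟨⊥, Submodule.fg_bot, bot_le, fun P _ => Set.mem_univ P⟩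
  | inter U V _ _ ihU ihV =>
    obtain ⟨F, hF, hFM, hFU⟩ := ihU hM.1
    obtain ⟨G, hG, hGM, hGV⟩ := ihV hM.2
    exact ⟨F ⊔ G, Submodule.FG.sup hF hG, sup_le hFM hGM, fun P hP =>
      ⟨hFU P (le_sup_left.trans hP), hGV P (le_sup_right.trans hP)⟩⟩
  | sUnion S _ ih =>
    obtain ⟨U, hU, hMU⟩ := hM
    obtain ⟨F, hF, hFM, hFU⟩ := ih U hU hMU
    exact ⟨F, hF, hFM, fun P hP => ⟨U, hU, hFU P hP⟩⟩

/-- As `ℤ` is discrete, continuity says that `f` is constant on a basic neighbourhood of each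
point. -/
theorem inverseContinuous_iff {X : Set (PrimeSpectrum R)} {f : X → ℤ} :
    InverseContinuous f ↔ ∀ M : X, ∃ F : Ideal R, F.FG ∧ F ≤ M.1.asIdeal ∧
      ∀ P : X, F ≤ P.1.asIdeal → f P = f M := by
  let _ := TopologicalSpace.induced (Subtype.val : X → _) (inverseTopology R)
  let _ : TopologicalSpace ℤ := ⊥
  have : DiscreteTopology ℤ := ⟨rfl⟩
  change Continuous f ↔ _
  rw [← IsLocallyConstant.iff_continuous]
  constructor
  · intro h M
    obtain ⟨U, hU, hUf⟩ := h {f M}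
    obtain ⟨F, hF, hFM, hFU⟩ := exists_fg_of_isOpen_inverseTopology hU (M := M.1)
      (by
        have : M ∈ f ⁻¹' {f M} := rfl
        rwa [← hUf] at this)
    refine ⟨F, hF, hFM, fun P hP => ?_⟩
    have : P ∈ Subtype.val ⁻¹' U := hFU P.1 hP
    rwa [hUf] at this
  · intro h
    rw [IsLocallyConstant.iff_exists_open]
    intro M
    obtain ⟨F, hF, hFM, hFP⟩ := h M
    refine ⟨Subtype.val ⁻¹' PrimeSpectrum.zeroLocus (F : Set R),
      ⟨_, TopologicalSpace.isOpen_generateFrom_of_mem ⟨F, hF, rfl⟩, rfl⟩, hFM, fun P hP => ?_⟩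
    exact hFP P hP

end InverseTopology

/-! ### Extensions to `D_P` and supports -/

section Extension

variable {D : Type*} [CommRing D] [IsDomain D]
variable {K : Type*} [Field K] [Algebra D K] [IsFractionRing D K]

omit [IsDomain D] in
theorem algebraMap_ne_zero_of_notMem {P : Ideal D} {s : D} (hs : s ∉ P) :
    algebraMap D K s ≠ 0 := fun h =>
  hs ((FaithfulSMul.algebraMap_eq_zero_iff D K).1 h ▸ zero_mem _)

theorem mem_localizationIn_iff {P : Ideal D} [P.IsPrime] {x : K} :
    x ∈ localizationIn K P ↔ ∃ s ∉ P, ∃ a, algebraMap D K s * x = algebraMap D K a := by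
  constructor
  · rintro ⟨a, s, hs, rfl⟩
    exact ⟨s, hs, a, by
      rw [mul_left_comm, mul_inv_cancel₀ (algebraMap_ne_zero_of_notMem hs), mul_one]⟩
  · rintro ⟨s, hs, a, h⟩
    exact ⟨a, s, hs, by rw [← h, mul_comm, inv_mul_cancel_left₀ (algebraMap_ne_zero_of_notMem hs)]⟩

theorem mem_extendAt_iff {I : FractionalIdeal D⁰ K} {P : Ideal D} [hP : P.IsPrime] {x : K} :
    x ∈ extendAt I P ↔ ∃ s ∉ P, algebraMap D K s * x ∈ I := by
  constructor
  · intro hx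
    refine Submodule.mul_induction_on hx (fun y hy z hz => ?_) (fun y z hy hz => ?_)
    · obtain ⟨s, hs, a, h⟩ := mem_localizationIn_iff.1 ((Subalgebra.mem_toSubmodule _).1 hz)
      refine ⟨s, hs, ?_⟩
      rw [mul_left_comm, h, mul_comm, ← Algebra.smul_def]
      exact Submodule.smul_mem (I : Submodule D K) a hy
    · obtain ⟨s, hs, h⟩ := hy
      obtain ⟨t, ht, h'⟩ := hz
      refine ⟨s * t, fun h => (hP.mem_or_mem h).elim hs ht, ?_⟩
      have : algebraMap D K (s * t) * (y + z) =
          t • (algebraMap D K s * y) + s • (algebraMap D K t * z) := by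
        rw [map_mul, Algebra.smul_def, Algebra.smul_def]; ring
      rw [this]
      exact Submodule.add_mem (I : Submodule D K) (Submodule.smul_mem (I : Submodule D K) _ h)
        (Submodule.smul_mem (I : Submodule D K) _ h')
  · rintro ⟨s, hs, h⟩
    have : x = (algebraMap D K s * x) * (algebraMap D K s)⁻¹ := by
      rw [mul_comm, inv_mul_cancel_left₀ (algebraMap_ne_zero_of_notMem hs)]
    rw [this]
    refine Submodule.mul_mem_mul h ((Subalgebra.mem_toSubmodule _).2 (mem_localizationIn_iff.2
      ⟨s, hs, 1, ?_⟩))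
    rw [mul_inv_cancel₀ (algebraMap_ne_zero_of_notMem hs), map_one]

theorem mem_fracSupport_coeIdeal {I : Ideal D} {P : PrimeSpectrum D} :
    P ∈ fracSupport (I : FractionalIdeal D⁰ K) ↔ I ≤ P.asIdeal := by
  rw [fracSupport, Set.mem_ofPred_eq, not_iff_comm]
  have hP := P.2
  constructor
  · intro h
    obtain ⟨s, hsI, hs⟩ := SetLike.not_le_iff_exists.1 h
    ext x
    rw [mem_extendAt_iff, Subalgebra.mem_toSubmodule, mem_localizationIn_iff]
    constructor
    · rintro ⟨t, ht, h⟩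
      obtain ⟨a, _, ha⟩ := (FractionalIdeal.mem_coeIdeal _).1 h
      exact ⟨t, ht, a, ha.symm⟩
    · rintro ⟨t, ht, a, h⟩
      refine ⟨s * t, fun h => (hP.mem_or_mem h).elim hs ht, ?_⟩
      rw [map_mul, mul_assoc, h, ← map_mul]
      exact FractionalIdeal.mem_coeIdeal_of_mem _ (I.mul_mem_right _ hsI)
  · intro h hle
    have h1 : (1 : K) ∈ extendAt (I : FractionalIdeal D⁰ K) P.asIdeal := by
      rw [h]; exact one_mem (localizationIn K P.asIdeal)
    obtain ⟨s, hs, hsI⟩ := mem_extendAt_iff.1 h1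
    rw [mul_one] at hsI
    obtain ⟨a, ha, has⟩ := (FractionalIdeal.mem_coeIdeal _).1 hsI
    exact hs (hle (FaithfulSMul.algebraMap_injective D K has ▸ ha))

/-- For an integral ideal the support is `V(I)`, and invertibility amounts to being nonzero and
finitely generated. -/
theorem coeIdeal_mem_InvOn_iff [IsPruferDomain D] {X : Set (PrimeSpectrum D)} {I : Ideal D} :
    (I : FractionalIdeal D⁰ K) ∈ InvOn K X ↔
      I.FG ∧ I ≠ ⊥ ∧ ∀ P : PrimeSpectrum D, I ≤ P.asIdeal → P ∈ X := by
  constructor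
  · rintro ⟨hu, hX⟩
    exact ⟨Ideal.fg_of_isUnit (FaithfulSMul.algebraMap_injective D K) I hu,
      FractionalIdeal.coeIdeal_ne_zero.1 hu.ne_zero,
      fun P hP => hX (mem_fracSupport_coeIdeal.2 hP)⟩
  · rintro ⟨hfg, h0, hX⟩
    exact ⟨hfg.isUnit_coeIdeal K h0, fun P hP => hX P (mem_fracSupport_coeIdeal.1 hP)⟩

omit [IsDomain D] in
/-- An ideal containing an invertible integral ideal divides it. -/
theorem Ideal.exists_mul_eq_of_le_of_isUnit {I R : Ideal D}
    (hR : IsUnit (R : FractionalIdeal D⁰ K)) (h : I ≤ R) : ∃ J, I = R * J := by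
  obtain ⟨u, hu⟩ := hR
  have hle : (I : FractionalIdeal D⁰ K) * (u⁻¹ : (FractionalIdeal D⁰ K)ˣ) ≤ 1 := by
    rw [← u.mul_inv, hu]
    gcongr
  obtain ⟨J, hJ⟩ := FractionalIdeal.le_one_iff_exists_coeIdeal.1 hle
  refine ⟨J, FractionalIdeal.coeIdeal_injective (K := K) ?_⟩
  simp only [FractionalIdeal.coeIdeal_mul, hJ, ← hu]
  rw [mul_left_comm, u.mul_inv, mul_one]

end Extension

/-! ### Local uniformizers on a discrete splitting set -/

section SplittingSet

variable {D : Type*} [CommRing D] [IsDomain D] {X : Set (PrimeSpectrum D)}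

/-- The zero ideal is an idempotent prime, so it does not belong to `X`. -/
theorem IsDiscreteSplittingSet.ne_bot (hX : IsDiscreteSplittingSet X) {I : Ideal D}
    (hI : ∀ P : PrimeSpectrum D, I ≤ P.asIdeal → P ∈ X) : I ≠ ⊥ := by
  rintro rfl
  refine hX.not_idempotent ⟨⊥, Ideal.isPrime_bot⟩ (hI _ le_rfl) ?_
  simp [pow_two]

omit [IsDomain D] in
theorem IsDiscreteSplittingSet.exists_fg_le (hX : IsDiscreteSplittingSet X)
    {M : PrimeSpectrum D} (hM : M ∈ X) :
    ∃ A : Ideal D, A.FG ∧ A ≤ M.asIdeal ∧ ∀ P : PrimeSpectrum D, A ≤ P.asIdeal → P ∈ X :=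
  exists_fg_of_isOpen_inverseTopology hX.isOpen_inverse hM

omit [IsDomain D] in
theorem IsDiscreteSplittingSet.exists_mem_notMem_sq (hX : IsDiscreteSplittingSet X)
    {M : PrimeSpectrum D} (hM : M ∈ X) : ∃ t ∈ M.asIdeal, t ∉ M.asIdeal ^ 2 :=
  SetLike.exists_of_lt (lt_of_le_of_ne (Ideal.pow_le_self two_ne_zero) (hX.not_idempotent M hM))

omit [IsDomain D] in
/-- As `V(J) ⊆ X` consists of maximal ideals, a radical `J ≤ M` extends to `M D_M`, which is not
`M ^ 2 D_M`. -/
theorem Ideal.IsRadical.not_le_sq (hX : IsDiscreteSplittingSet X)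
    (hmax : ∀ P ∈ X, P.asIdeal.IsMaximal) {J : Ideal D} (hJ : J.IsRadical)
    (hJX : ∀ P : PrimeSpectrum D, J ≤ P.asIdeal → P ∈ X) {M : PrimeSpectrum D} (hM : M ∈ X) :
    ¬ J ≤ M.asIdeal ^ 2 := by
  intro hle
  obtain ⟨t, ht, ht2⟩ := hX.exists_mem_notMem_sq hM
  obtain ⟨s, hs, h⟩ := exists_mul_mem_radical M.2 (fun P hP => hmax P (hJX P hP)) ht
  rw [hJ.radical] at h
  exact ht2 ((hmax M hM).mem_pow_of_mul_mem hs (hle h))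

variable [IsPruferDomain D]

/-- If `V(B) ⊆ X` and `B ⊄ P ^ 2` for all `P ∈ V(B)`, then `B D_P = P D_P` for the maximal ideals
`P ⊇ B`, so `B` is locally radical. The local check is made on the ideal `(B : x)`, for `x` in the
radical of `B`. -/
theorem Ideal.isRadical_of_forall_not_le_sq {B : Ideal D}
    (hBX : ∀ P : PrimeSpectrum D, B ≤ P.asIdeal → P ∈ X)
    (h : ∀ P ∈ X, B ≤ P.asIdeal → ¬ B ≤ P.asIdeal ^ 2) : B.IsRadical := by
  intro x hx
  by_contra hxB
  have hne : B.colon {x} ≠ ⊤ := by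
    rw [Ne, Ideal.eq_top_iff_one, Submodule.mem_colon_singleton]
    simpa using hxB
  obtain ⟨P, hP, hle⟩ := Ideal.exists_le_maximal _ hne
  have hBP : B ≤ P := fun y hy => hle (Submodule.mem_colon_singleton.2 (B.mul_mem_right _ hy))
  have hPX := hBX ⟨P, hP.isPrime⟩ hBP
  obtain ⟨t, htB, ht2⟩ := SetLike.not_le_iff_exists.1 (h _ hPX hBP)
  have hxP : x ∈ P := (hP.isPrime.radical_le_iff.2 hBP) hx
  obtain ⟨s, hs, c, hc⟩ := exists_mul_eq_mul_pow hP ht2 1 (x := x) (by simpa using hxP)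
  refine hs (hle (Submodule.mem_colon_singleton.2 ?_))
  rw [smul_eq_mul, hc, pow_one]
  exact B.mul_mem_left _ htB

/-- A local uniformizer of `X` at `M`: an element `t` of `M` that generates `P D_P` for all `P` in
a neighbourhood `V(F) ∩ X` of `M` in the inverse topology. As `t ∈ F`, this is expressed by
`t ∉ P ^ 2`. -/
def HasLocalUniformizer (X : Set (PrimeSpectrum D)) (M : PrimeSpectrum D) : Prop :=
  ∃ F : Ideal D, F.FG ∧ F ≤ M.asIdeal ∧ ∃ t ∈ F, ∀ P ∈ X, F ≤ P.asIdeal → t ∉ P.asIdeal ^ 2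

/-- A generator `t ∈ J` of `J` at `M` generates `J` at all `P` near `M`, where `J D_P = P D_P`. -/
theorem hasLocalUniformizer_of_isRadical (hX : IsDiscreteSplittingSet X)
    (hmax : ∀ P ∈ X, P.asIdeal.IsMaximal) {J : Ideal D} (hJ : J.IsRadical) (hfg : J.FG)
    (hJX : ∀ P : PrimeSpectrum D, J ≤ P.asIdeal → P ∈ X) {M : PrimeSpectrum D}
    (hJM : J ≤ M.asIdeal) : HasLocalUniformizer X M := by
  have hM := hJX M hJM
  have hMp := M.2
  obtain ⟨t, htJ, s, hs, h⟩ := hfg.exists_local_generator M.asIdeal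
  obtain ⟨r, hr⟩ := (hmax M hM).exists_one_sub_mul_mem hs
  refine ⟨J ⊔ Ideal.span {1 - r * s}, Submodule.FG.sup hfg (Submodule.fg_span_singleton _),
    sup_le hJM ((Ideal.span_singleton_le_iff_mem _).2 hr), t, Ideal.mem_sup_left htJ,
    fun P hP hle ht => ?_⟩
  have hsP := P.2.notMem_of_one_sub_mul_mem
    ((Ideal.span_singleton_le_iff_mem _).1 (le_sup_right.trans hle))
  refine hJ.not_le_sq hX hmax hJX hP fun y hy => (hmax P hP).mem_pow_of_mul_mem hsP ?_
  obtain ⟨c, hc⟩ := h y hy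
  rw [hc]
  exact Ideal.mul_mem_left _ _ ht

variable (K : Type*) [Field K] [Algebra D K] [IsFractionRing D K]

/-- A point of `X` is not critical if and only if it has a local uniformizer `t`: locally, a
finitely generated radical ideal is generated by such a `t`, and conversely the ideal `F` of the
neighbourhood `V(F)` becomes radical once it is enlarged so that `V(F) ⊆ X`. -/
theorem notMem_criticalSet_iff (hX : IsDiscreteSplittingSet X)
    (hmax : ∀ P ∈ X, P.asIdeal.IsMaximal) {M : PrimeSpectrum D} (hM : M ∈ X) :
    M ∉ criticalSet K X ↔ HasLocalUniformizer X M := by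
  rw [criticalSet, Set.mem_ofPred_eq, not_and_not_right]
  simp only [coeIdeal_mem_InvOn_iff]
  constructor
  · intro h
    obtain ⟨J, hJ, ⟨hfg, -, hJX⟩, hJM⟩ := h hM
    exact hasLocalUniformizer_of_isRadical hX hmax hJ hfg hJX hJM
  · rintro ⟨F, hF, hFM, t, ht, h⟩ -
    obtain ⟨A, hA, hAM, hAX⟩ := hX.exists_fg_le hM
    have hBX : ∀ P : PrimeSpectrum D, F ⊔ A ≤ P.asIdeal → P ∈ X := fun P hP =>
      hAX P (le_sup_right.trans hP)
    exact ⟨F ⊔ A, Ideal.isRadical_of_forall_not_le_sq hBX fun P hP hle hle2 =>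
      h P hP (le_sup_left.trans hle) (hle2 (Ideal.mem_sup_left ht)),
      ⟨Submodule.FG.sup hF hA, hX.ne_bot hBX, hBX⟩, sup_le hFM hAM⟩

/-- If no prime containing `I` is critical, local uniformizers can be moved into the radical of
`I`, and by quasi-compactness finitely many of them generate it together with `I`. -/
theorem radical_fg_of_hasLocalUniformizer (hmax : ∀ P ∈ X, P.asIdeal.IsMaximal) {I : Ideal D}
    (hfg : I.FG) (hIX : ∀ P : PrimeSpectrum D, I ≤ P.asIdeal → P ∈ X)
    (h : ∀ M : PrimeSpectrum D, I ≤ M.asIdeal → HasLocalUniformizer X M) : I.radical.FG := by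
  have key : ∀ M : PrimeSpectrum D, ∃ (C : Ideal D) (b : D), C.FG ∧ b ∈ I.radical ∧
      (I ≤ M.asIdeal → C ≤ M.asIdeal ∧
        ∀ P ∈ X, C ≤ P.asIdeal → b ∉ P.asIdeal ^ 2) := by
    intro M
    by_cases hM : I ≤ M.asIdeal
    · obtain ⟨F, hF, hFM, t, ht, htP⟩ := h M hM
      obtain ⟨s, hs, hst⟩ := exists_mul_mem_radical M.2 (fun P hP => hmax P (hIX P hP)) (hFM ht)
      obtain ⟨r, hr⟩ := (hmax M (hIX M hM)).exists_one_sub_mul_mem hs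
      refine ⟨F ⊔ Ideal.span {1 - r * s}, s * t,
        Submodule.FG.sup hF (Submodule.fg_span_singleton _), hst, fun _ =>
        ⟨sup_le hFM ((Ideal.span_singleton_le_iff_mem _).2 hr), fun P hP hle hb => ?_⟩⟩
      exact htP P hP (le_sup_left.trans hle) ((hmax P hP).mem_pow_of_mul_mem
        (P.2.notMem_of_one_sub_mul_mem
          ((Ideal.span_singleton_le_iff_mem _).1 (le_sup_right.trans hle))) hb)
    · exact ⟨⊥, 0, Submodule.fg_bot, zero_mem _, fun h => absurd h hM⟩
  choose C b hC hb hCb using key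
  obtain ⟨S, hS⟩ := exists_finset_cover_zeroLocus I C hC fun M hM => (hCb M hM).1
  have hBX : ∀ P : PrimeSpectrum D, I ⊔ Ideal.span (b '' S) ≤ P.asIdeal → P ∈ X := fun P hP =>
    hIX P (le_sup_left.trans hP)
  have hrad : (I ⊔ Ideal.span (b '' S)).IsRadical := by
    refine Ideal.isRadical_of_forall_not_le_sq hBX fun P hP hle hle2 => ?_
    obtain ⟨M, hM, hIM, hCP⟩ := hS P (le_sup_left.trans hle)
    exact (hCb M hIM).2 P hP hCP (hle2 (Ideal.mem_sup_right
      (Ideal.subset_span (Set.mem_image_of_mem b hM))))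
  have heq : I.radical = I ⊔ Ideal.span (b '' S) := by
    refine le_antisymm (hrad.radical_le_iff.2 le_sup_left) (sup_le Ideal.le_radical ?_)
    rw [Ideal.span_le]
    rintro _ ⟨M, -, rfl⟩
    exact hb M
  rw [heq]
  exact Submodule.FG.sup hfg (Submodule.fg_span (S.finite_toSet.image b))

/-- Dividing `I` by its radical, which is invertible, lowers every positive value of `I` by one; if
the values of `I` are at most `n`, a factorization is reached after `n` steps. -/
theorem hasRadicalFactorization_of_hasLocalUniformizer (hX : IsDiscreteSplittingSet X)
    (hmax : ∀ P ∈ X, P.asIdeal.IsMaximal) (n : ℕ) {I : Ideal D}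
    (hfg : I.FG) (hIX : ∀ P : PrimeSpectrum D, I ≤ P.asIdeal → P ∈ X)
    (h : ∀ M : PrimeSpectrum D, I ≤ M.asIdeal → HasLocalUniformizer X M)
    (hn : ∀ P ∈ X, ¬ I ≤ P.asIdeal ^ (n + 1)) : HasRadicalFactorization I := by
  induction n generalizing I with
  | zero =>
    refine ⟨0, Fin.elim0, fun i => i.elim0, ?_⟩
    rw [Finset.univ_eq_empty, Finset.prod_empty, Ideal.one_eq_top]
    by_contra hne
    obtain ⟨P, hP, hle⟩ := Ideal.exists_le_maximal I hne
    exact hn _ (hIX ⟨P, hP.isPrime⟩ hle) (by simpa using hle)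
  | succ n ih =>
    have hR := radical_fg_of_hasLocalUniformizer hmax hfg hIX h
    have hR0 : I.radical ≠ ⊥ := hX.ne_bot fun P hP => hIX P (Ideal.le_radical.trans hP)
    obtain ⟨J, hJ⟩ := Ideal.exists_mul_eq_of_le_of_isUnit
      (hR.isUnit_coeIdeal (FractionRing D) hR0) Ideal.le_radical
    have hIJ : I ≤ J := hJ.trans_le Ideal.mul_le_right
    have hJfg : J.FG := by
      refine Ideal.fg_of_isUnit (S := D⁰)
        (FaithfulSMul.algebraMap_injective D (FractionRing D)) J ?_
      have := hfg.isUnit_coeIdeal (FractionRing D) (hX.ne_bot hIX)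
      rw [hJ, FractionalIdeal.coeIdeal_mul] at this
      exact isUnit_of_mul_isUnit_right this
    obtain ⟨m, F, hF, hprod⟩ := ih hJfg (fun P hP => hIX P (hIJ.trans hP))
      (fun P hP => h P (hIJ.trans hP)) fun P hP hle => hn P hP (by
        rw [hJ, pow_succ']
        refine Ideal.mul_mono ?_ hle
        exact P.2.radical_le_iff.2 (hIJ.trans (hle.trans (Ideal.pow_le_self n.succ_ne_zero))))
    refine ⟨m + 1, Fin.cons I.radical F, Fin.cases ⟨hR, I.radical_isRadical⟩ hF, ?_⟩
    rw [Fin.prod_univ_succ, Fin.cons_zero]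
    simpa only [Fin.cons_succ, ← hprod] using hJ

/-- If the radical of `I` is finitely generated, the values of `I` are bounded on `X`. -/
theorem exists_forall_not_le_pow (hX : IsDiscreteSplittingSet X)
    (hmax : ∀ P ∈ X, P.asIdeal.IsMaximal) {I : Ideal D}
    (hIX : ∀ P : PrimeSpectrum D, I ≤ P.asIdeal → P ∈ X) (hR : I.radical.FG) :
    ∃ n : ℕ, ∀ P ∈ X, ¬ I ≤ P.asIdeal ^ (n + 1) := by
  obtain ⟨n, hn⟩ := I.exists_radical_pow_le_of_fg hR
  refine ⟨n, fun P hP hle => ?_⟩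
  have hIP : I ≤ P.asIdeal := hle.trans (Ideal.pow_le_self n.succ_ne_zero)
  obtain ⟨t, htR, ht2⟩ := SetLike.not_le_iff_exists.1 (I.radical_isRadical.not_le_sq hX hmax
    (fun P hP => hIX P (Ideal.le_radical.trans hP)) hP)
  have := le_of_mul_pow_mem (hmax P hP) (P.2.radical_le_iff.2 hIP htR) ht2 P.2.one_notMem
    (n := n) (k := n + 1) (by simpa using hle (hn (Ideal.pow_mem_pow htR n)))
  omega

omit [IsDomain D] [IsPruferDomain D] in
theorem exists_isRadical_of_hasRadicalFactorization {I : Ideal D}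
    (h : HasRadicalFactorization I) {M : Ideal D} (hM : M.IsPrime) (hIM : I ≤ M) :
    ∃ J : Ideal D, J.FG ∧ J.IsRadical ∧ I ≤ J ∧ J ≤ M := by
  obtain ⟨n, J, hJ, rfl⟩ := h
  obtain ⟨i, -, hi⟩ := hM.prod_le.1 hIM
  exact ⟨J i, (hJ i).1, (hJ i).2, Ideal.prod_le_inf.trans (Finset.inf_le (Finset.mem_univ i)), hi⟩

end SplittingSet

/-! ### Local generators of fractional ideals -/

section LocalGenerator

variable {D : Type*} [CommRing D] [IsDomain D]
variable {K : Type*} [Field K] [Algebra D K] [IsFractionRing D K]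

/-- The equality `I D_P = x D_P`, witnessed by a single denominator `s ∉ P`. -/
def IsLocalGenerator (I : FractionalIdeal D⁰ K) (P : Ideal D) (x : K) : Prop :=
  ∃ s ∉ P, algebraMap D K s * x ∈ I ∧ ∀ y ∈ I, ∃ c, algebraMap D K s * y = algebraMap D K c * x

/-- If `1 = ∑ aᵢ bᵢ` with `aᵢ ∈ I` and `bᵢ ∈ I⁻¹`, some `aᵢ bᵢ` is not in `P`, and then `aᵢ`
generates `I` at `P`. -/
theorem exists_isLocalGenerator {I : FractionalIdeal D⁰ K} (hI : IsUnit I) (P : Ideal D)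
    [hP : P.IsPrime] : ∃ x, IsLocalGenerator I P x := by
  have hI0 : I ≠ 0 := hI.ne_zero
  have hmul := (FractionalIdeal.mul_inv_cancel_iff_isUnit K).2 hI
  by_contra! hcon
  have hle : I * I⁻¹ ≤ (P : FractionalIdeal D⁰ K) := by
    rw [FractionalIdeal.mul_le]
    intro a ha b hb
    obtain ⟨s, hs⟩ := (FractionalIdeal.mem_one_iff _).1
      ((FractionalIdeal.mem_inv_iff hI0).1 hb a ha)
    by_contra hab
    have hsP : s ∉ P := fun h => hab (by
      rw [mul_comm, ← hs]; exact FractionalIdeal.mem_coeIdeal_of_mem _ h)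
    refine hcon a ⟨s, hsP, ?_, fun y hy => ?_⟩
    · rw [← Algebra.smul_def]
      exact Submodule.smul_mem (I : Submodule D K) s ha
    · obtain ⟨c, hc⟩ := (FractionalIdeal.mem_one_iff _).1
        ((FractionalIdeal.mem_inv_iff hI0).1 hb y hy)
      exact ⟨c, by rw [hs, hc]; ring⟩
  rw [hmul, ← FractionalIdeal.coeIdeal_top, FractionalIdeal.coeIdeal_le_coeIdeal] at hle
  exact hP.ne_top (top_le_iff.1 hle)

omit [IsDomain D] [IsFractionRing D K] in
/-- Local generation spreads to a neighbourhood: if `s ∉ M` witnesses it at `M` and `1 - r s ∈ M`,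
then `s` witnesses it at every prime containing `1 - r s`. -/
theorem IsLocalGenerator.exists_fg {I : FractionalIdeal D⁰ K} {M : Ideal D} (hM : M.IsMaximal)
    {x : K} (h : IsLocalGenerator I M x) : ∃ C : Ideal D, C.FG ∧ C ≤ M ∧
      ∀ P : PrimeSpectrum D, C ≤ P.asIdeal → IsLocalGenerator I P.asIdeal x := by
  obtain ⟨s, hs, h⟩ := h
  obtain ⟨r, hr⟩ := hM.exists_one_sub_mul_mem hs
  exact ⟨Ideal.span {1 - r * s}, Submodule.fg_span_singleton _,
    (Ideal.span_singleton_le_iff_mem _).2 hr, fun P hP =>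
    ⟨s, P.2.notMem_of_one_sub_mul_mem ((Ideal.span_singleton_le_iff_mem _).1 hP), h⟩⟩

/-- An integral ideal with generator `t ^ n` at `P`, where `t` is a uniformizer at `P`, lies in
`P ^ k` only if `k ≤ n`. -/
theorem IsLocalGenerator.le_of_le_pow {I P : Ideal D} [IsPruferDomain D] (hP : P.IsMaximal) {t : D}
    (ht : t ∈ P) (ht2 : t ∉ P ^ 2) {n : ℤ}
    (h : IsLocalGenerator (I : FractionalIdeal D⁰ K) P (algebraMap D K t ^ n)) {k : ℕ}
    (hk : I ≤ P ^ k) : k ≤ n := by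
  obtain ⟨s, hs, hsI, -⟩ := h
  obtain ⟨a, ha, hst⟩ := (FractionalIdeal.mem_coeIdeal _).1 hsI
  have ht0 : algebraMap D K t ≠ 0 := algebraMap_ne_zero_of_notMem ht2
  have hinj := FaithfulSMul.algebraMap_injective D K
  obtain ⟨m, rfl | rfl⟩ := n.eq_nat_or_neg
  · have : a = s * t ^ m := hinj (by rw [hst]; simp)
    exact_mod_cast le_of_mul_pow_mem hP ht ht2 hs (this ▸ hk ha)
  · have : a * t ^ m = s * t ^ 0 := hinj (by
      rw [map_mul, hst, map_pow, mul_assoc, zpow_neg, zpow_natCast,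
        inv_mul_cancel₀ (pow_ne_zero _ ht0)]; simp)
    by_contra! hlt
    have := le_of_mul_pow_mem hP ht ht2 hs (n := 0) (k := k + m) (by
      rw [← this, pow_add]
      exact Ideal.mul_mem_mul (hk ha) (Ideal.pow_mem_pow ht m))
    omega

omit [IsDomain D] in
theorem IsLocalGenerator.le_pow {I P : Ideal D} (hP : P.IsMaximal) {t : D} {k n : ℕ}
    (ht : t ∈ P ^ k) (h : IsLocalGenerator (I : FractionalIdeal D⁰ K) P (algebraMap D K t ^ n)) :
    I ≤ P ^ (k * n) := by
  obtain ⟨s, hs, -, h⟩ := h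
  intro y hy
  obtain ⟨c, hc⟩ := h _ (FractionalIdeal.mem_coeIdeal_of_mem _ hy)
  have : s * y = c * t ^ n := FaithfulSMul.algebraMap_injective D K (by simpa using hc)
  refine hP.mem_pow_of_mul_mem hs (this ▸ Ideal.mul_mem_left _ _ ?_)
  rw [pow_mul]
  exact Ideal.pow_mem_pow ht n

omit [IsDomain D] [IsFractionRing D K] in
theorem IsLocalGenerator.congr {I : FractionalIdeal D⁰ K} {P : Ideal D} (hP : P.IsPrime) {x y : K}
    (h : IsLocalGenerator I P x) {a b : D} (ha : a ∉ P) (hb : b ∉ P)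
    (hab : algebraMap D K a * y = algebraMap D K b * x) : IsLocalGenerator I P y := by
  obtain ⟨s, hs, hsI, h⟩ := h
  refine ⟨s * a * b, by simp [hP.mul_mem_iff_mem_or_mem, hs, ha, hb], ?_, fun z hz => ?_⟩
  · have : algebraMap D K (s * a * b) * y = (b * b) • (algebraMap D K s * x) := by
      rw [Algebra.smul_def, map_mul, map_mul, map_mul]
      linear_combination algebraMap D K s * algebraMap D K b * hab
    rw [this]
    exact Submodule.smul_mem (I : Submodule D K) _ hsI
  · obtain ⟨c, hc⟩ := h z hz
    refine ⟨c * a * a, ?_⟩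
    simp only [map_mul]
    linear_combination algebraMap D K a * algebraMap D K b * hc -
      algebraMap D K a * algebraMap D K c * hab

theorem isLocalGenerator_one {I P : Ideal D} (h : ¬ I ≤ P) :
    IsLocalGenerator (I : FractionalIdeal D⁰ K) P 1 := by
  obtain ⟨s, hsI, hs⟩ := SetLike.not_le_iff_exists.1 h
  refine ⟨s, hs, by
    simpa using FractionalIdeal.mem_coeIdeal_of_mem (P := K) D⁰ hsI, fun y hy => ?_⟩
  obtain ⟨a, -, rfl⟩ := (FractionalIdeal.mem_coeIdeal _).1 hy
  exact ⟨s * a, by simp⟩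

end LocalGenerator

/-! ### The prime `⋂ n, P ^ n` -/

section PowInf

variable {D : Type*} [CommRing D] [IsDomain D]

omit [IsDomain D] in
theorem powInf_le (P : Ideal D) (n : ℕ) : powInf P ≤ P ^ n := iInf_le _ n

variable [IsPruferDomain D]

/-- `⋂ n, P ^ n` is the contraction of the prime `⋂ n, (P D_P) ^ n` of the valuation ring `D_P`. -/
theorem powInf_isPrime {P : Ideal D} [P.IsMaximal] (hP : P ^ 2 ≠ P) : (powInf P).IsPrime := by
  have hp := powInf_maximalIdeal_isPrime (maximalIdeal_not_idempotent (FractionRing D) hP)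
  have : powInf P = (powInf (IsLocalRing.maximalIdeal
      (localizationIn (FractionRing D) P))).comap (algebraMap D _) := by
    rw [powInf, powInf, Ideal.comap_iInf]
    exact iInf_congr fun n =>
      (IsLocalization.AtPrime.under_maximalIdeal_pow P (localizationIn (FractionRing D) P) n).symm
  rw [this]
  exact hp.comap _

/-- Up to elements outside `P`, an element outside `powInf P` is a power of a uniformizer at `P`. -/
theorem exists_mul_eq_mul_pow_of_notMem_powInf {P : Ideal D} (hP : P.IsMaximal) {t : D}
    (ht : t ∈ P) (ht2 : t ∉ P ^ 2) {x : D} (hx : x ∉ powInf P) :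
    ∃ (n : ℕ), ∃ s ∉ P, ∃ c ∉ P, s * x = c * t ^ n := by
  classical
  have hex : ∃ n, x ∉ P ^ n := by
    by_contra! h
    exact hx ((Submodule.mem_iInf _).2 h)
  obtain ⟨k, hk⟩ : ∃ k, Nat.find hex = k + 1 :=
    Nat.exists_eq_succ_of_ne_zero (fun h0 => Nat.find_spec hex (by rw [h0]; simp))
  have h1 : x ∈ P ^ k := not_not.1 (Nat.find_min hex (m := k) (by omega))
  have h2 : x ∉ P ^ (k + 1) := hk ▸ Nat.find_spec hex
  obtain ⟨s, hs, c, hc⟩ := exists_mul_eq_mul_pow hP ht2 k h1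
  refine ⟨k, s, hs, c, fun hcP => h2 (hP.mem_pow_of_mul_mem hs ?_), hc⟩
  rw [hc, pow_succ']
  exact Ideal.mul_mem_mul hcP (Ideal.pow_mem_pow ht k)

end PowInf

/-! ### The value of a fractional ideal at a point -/

section ResidueVal

variable {D : Type*} [CommRing D] [IsDomain D] [IsPruferDomain D]
variable {K : Type*} [Field K] [Algebra D K] [IsFractionRing D K]
variable {P : Ideal D} [hmax : P.IsMaximal]

theorem maximalIdeal_localizationIn_eq_span {t : D} (ht : t ∈ P) (ht2 : t ∉ P ^ 2) :
    IsLocalRing.maximalIdeal (localizationIn K P) =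
      Ideal.span {algebraMap D (localizationIn K P) t} := by
  rw [← IsLocalization.AtPrime.map_eq_maximalIdeal P (localizationIn K P)]
  apply le_antisymm
  · rw [Ideal.map_le_iff_le_comap]
    intro a ha
    obtain ⟨s, hs, c, hc⟩ := exists_mul_eq_mul_pow hmax ht2 1 (x := a) (by simpa using ha)
    have hu : IsUnit (algebraMap D (localizationIn K P) s) :=
      IsLocalization.map_units (localizationIn K P) (⟨s, hs⟩ : P.primeCompl)
    rw [Ideal.mem_comap, Ideal.mem_span_singleton, ← hu.dvd_mul_left, ← map_mul, hc, pow_one,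
      map_mul]
    exact dvd_mul_left _ _
  · exact (Ideal.span_singleton_le_iff_mem _).2 (Ideal.mem_map_of_mem _ ht)

/-- An element of `P` outside `P ^ 2` is a uniformizer of the discrete valuation ring
`D_P / Q D_P`. -/
theorem residueVal_unit_mul_pow (hP : P ^ 2 ≠ P) {t : D} (ht : t ∈ P) (ht2 : t ∉ P ^ 2)
    (u : (localizationIn K P)ˣ) (n : ℕ) :
    residueVal hP ((u : localizationIn K P) * algebraMap D (localizationIn K P) t ^ n) = n := by
  have hdom := residueRing_isDomain K hP
  have hdvr := residueRing_isDiscreteValuationRing K hP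
  have hsurj : Function.Surjective (Ideal.Quotient.mk
      ((powInf P).map (algebraMap D (localizationIn K P)))) := Ideal.Quotient.mk_surjective
  have hirr : Irreducible (Ideal.Quotient.mk
      ((powInf P).map (algebraMap D (localizationIn K P))) (algebraMap D _ t)) := by
    rw [IsDiscreteValuationRing.irreducible_iff_uniformizer, ← Set.image_singleton,
      ← Ideal.map_span, ← maximalIdeal_localizationIn_eq_span ht ht2]
    exact (IsLocalRing.map_maximalIdeal_of_surjective _ hsurj).symm
  rw [residueVal, map_mul, map_pow]
  exact IsDiscreteValuationRing.addVal_def' (Units.map (Ideal.Quotient.mk _).toMonoidHom u) hirr n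

theorem exists_eq_unit_mul_pow_of_residueVal_ne_top (hP : P ^ 2 ≠ P) {t : D} (ht : t ∈ P)
    (ht2 : t ∉ P ^ 2) {a : localizationIn K P} (ha : residueVal hP a ≠ ⊤) :
    ∃ (u : (localizationIn K P)ˣ) (n : ℕ), a = u * algebraMap D (localizationIn K P) t ^ n := by
  have hdom := residueRing_isDomain K hP
  have hdvr := residueRing_isDiscreteValuationRing K hP
  refine exists_eq_unit_mul_pow (maximalIdeal_localizationIn_eq_span ht ht2) fun h => ha ?_
  rw [residueVal, IsDiscreteValuationRing.addVal_eq_top_iff, Ideal.Quotient.eq_zero_iff_mem,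
    map_powInf]
  exact h

/-- If `I D_P = t ^ n D_P` with `t` a uniformizer at `P`, then `n` is the least value of a nonzero
element of `I D_P / Q D_P`: nonzero elements are the classes of unit multiples of the `t ^ (i - j)`,
and those in `t ^ n D_P` have `i - j ≥ n`. -/
theorem IsLocalGenerator.localValue_eq (hP : P ^ 2 ≠ P) {t : D} (ht : t ∈ P) (ht2 : t ∉ P ^ 2)
    {I : FractionalIdeal D⁰ K} {n : ℤ} (h : IsLocalGenerator I P (algebraMap D K t ^ n)) :
    localValue hP I = n := by
  have ht0 : algebraMap D K t ≠ 0 := algebraMap_ne_zero_of_notMem ht2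
  have hpow : ∀ m : ℕ, residueVal hP (algebraMap D (localizationIn K P) t ^ m) = m := fun m => by
    simpa using residueVal_unit_mul_pow hP ht ht2 (1 : (localizationIn K P)ˣ) m
  obtain ⟨s, hs, hsI, hI⟩ := h
  refine IsLeast.csInf_eq ⟨⟨algebraMap D _ t ^ n.toNat, algebraMap D _ t ^ (-n).toNat, ?_, ?_,
    ?_, ?_⟩, ?_⟩
  · simp [hpow]
  · simp [hpow]
  · rw [mem_extendAt_iff]
    refine ⟨s, hs, ?_⟩
    convert hsI using 2
    push_cast
    rw [← zpow_natCast, ← zpow_natCast, ← zpow_sub₀ ht0]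
    congr 1
    omega
  · rw [hpow, hpow, ENat.toNat_natCast, ENat.toNat_natCast]
    omega
  · rintro _ ⟨a, b, ha, hb, hab, rfl⟩
    obtain ⟨u, i, rfl⟩ := exists_eq_unit_mul_pow_of_residueVal_ne_top hP ht ht2 ha
    obtain ⟨w, j, rfl⟩ := exists_eq_unit_mul_pow_of_residueVal_ne_top hP ht ht2 hb
    rw [residueVal_unit_mul_pow hP ht ht2, residueVal_unit_mul_pow hP ht ht2, ENat.toNat_natCast,
      ENat.toNat_natCast]
    obtain ⟨r, hr, hrI⟩ := mem_extendAt_iff.1 hab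
    obtain ⟨c, hc⟩ := hI _ hrI
    -- If `i - j < n`, then `s r u = c w t ^ (k + 1)` with a unit on the left.
    by_contra! hlt
    obtain ⟨k, hk⟩ : ∃ k : ℕ, n + j = i + (k + 1 : ℕ) := ⟨(n + j - i - 1).toNat, by omega⟩
    have hw : ((w : localizationIn K P) : K) ≠ 0 := by simp
    have hpow' : algebraMap D K t ^ n * algebraMap D K t ^ j =
        algebraMap D K t ^ i * algebraMap D K t ^ (k + 1) := by
      rw [← zpow_natCast, ← zpow_natCast, ← zpow_natCast, ← zpow_add₀ ht0, hk, zpow_add₀ ht0]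
    have heq : (algebraMap D (localizationIn K P) s * algebraMap D (localizationIn K P) r) * u =
        algebraMap D (localizationIn K P) c * w *
          algebraMap D (localizationIn K P) t ^ (k + 1) := by
      apply Subtype.ext
      push_cast at hc ⊢
      rw [mul_div_assoc', mul_div_assoc', div_eq_iff (mul_ne_zero hw (pow_ne_zero _ ht0))] at hc
      refine mul_right_cancel₀ (pow_ne_zero i ht0) ?_
      linear_combination hc + algebraMap D K c * w * hpow'
    have hu : ∀ s ∉ P, IsUnit (algebraMap D (localizationIn K P) s) := fun s hs =>
      IsLocalization.map_units (localizationIn K P) (⟨s, hs⟩ : P.primeCompl)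
    have hunit := (((hu s hs).mul (hu r hr)).mul u.isUnit)
    rw [heq] at hunit
    have htu := isUnit_of_mul_isUnit_right hunit
    rw [isUnit_pow_iff k.succ_ne_zero] at htu
    refine (IsLocalRing.mem_maximalIdeal _).1 ?_ htu
    rw [maximalIdeal_localizationIn_eq_span ht ht2]
    exact Ideal.mem_span_singleton_self _

end ResidueVal

/-! ### Evaluability of the ideals of `Inv_X(D)` -/

section Evaluability

variable {D : Type*} [CommRing D] [IsDomain D] [IsPruferDomain D]
variable {K : Type*} [Field K] [Algebra D K] [IsFractionRing D K]
variable {X : Set (PrimeSpectrum D)}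

/-- An ideal `I` of `Inv_X(D)` is a power of a uniformizer at each `P ∈ X`: since `⋂ n, P ^ n` is
a prime outside `X`, a local generator of `I` at `P` is a quotient of elements not in
`⋂ n, P ^ n`. -/
theorem exists_zpow_isLocalGenerator (hX : IsDiscreteSplittingSet X)
    (hmax : ∀ P ∈ X, P.asIdeal.IsMaximal) {I : FractionalIdeal D⁰ K} (hI : I ∈ InvOn K X)
    {P : PrimeSpectrum D} (hP : P ∈ X) {t : D} (ht : t ∈ P.asIdeal) (ht2 : t ∉ P.asIdeal ^ 2) :
    ∃ n : ℤ, IsLocalGenerator I P.asIdeal (algebraMap D K t ^ n) := by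
  have hPm := hmax P hP
  have hPp := P.2
  have hQ := powInf_isPrime (hX.not_idempotent P hP)
  have hQP : powInf P.asIdeal ≤ P.asIdeal := by simpa using powInf_le P.asIdeal 1
  -- `X` consists of maximal ideals, so `Q ∈ X` would force `Q = P`, although `Q ≤ P ^ 2`.
  have hQX : (⟨powInf P.asIdeal, hQ⟩ : PrimeSpectrum D) ∉ X := fun h =>
    ht2 (powInf_le P.asIdeal 2 (((hmax _ h).eq_of_le hPp.ne_top hQP).ge ht))
  have hext : extendAt I (powInf P.asIdeal) =
      Subalgebra.toSubmodule (localizationIn K (powInf P.asIdeal)) := by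
    by_contra h
    exact hQX (hI.2 h)
  obtain ⟨x, hx⟩ := exists_isLocalGenerator hI.1 P.asIdeal
  obtain ⟨s, hs, hsI, h⟩ := id hx
  have h1 : (1 : K) ∈ extendAt I (powInf P.asIdeal) := by
    rw [hext]; exact one_mem (localizationIn K (powInf P.asIdeal))
  obtain ⟨a, haQ, haI⟩ := mem_extendAt_iff.1 h1
  rw [mul_one] at haI
  have h2 : algebraMap D K s * x ∈ extendAt I (powInf P.asIdeal) :=
    mem_extendAt_iff.2 ⟨1, hQ.one_notMem, by simpa using hsI⟩
  rw [hext, Subalgebra.mem_toSubmodule, mem_localizationIn_iff] at h2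
  obtain ⟨e, he, d, hd⟩ := h2
  obtain ⟨c, hc⟩ := h _ haI
  -- As `I D_Q = D_Q`, the generator `x` is a unit of `D_Q`; it is `s a / c` with `s`, `a`, `c` not
  -- in `Q`, and each of `a` and `c` is a power of `t` up to elements outside `P`.
  have hcQ : c ∉ powInf P.asIdeal := by
    have hsQ : s ∉ powInf P.asIdeal := fun h => hs (hQP h)
    have : e * s * (s * a) = c * d := FaithfulSMul.algebraMap_injective D K (by
      simp only [map_mul]
      linear_combination algebraMap D K e * algebraMap D K s * hc + algebraMap D K c * hd)
    intro hcQ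
    have := this ▸ Ideal.mul_mem_right d _ hcQ
    simp [hQ.mul_mem_iff_mem_or_mem, hsQ, haQ, he] at this
  obtain ⟨i, r, hr, u, hu, hcu⟩ := exists_mul_eq_mul_pow_of_notMem_powInf hPm ht ht2 hcQ
  obtain ⟨j, r', hr', u', hu', hau⟩ := exists_mul_eq_mul_pow_of_notMem_powInf hPm ht ht2 haQ
  have ht0 : algebraMap D K t ≠ 0 := algebraMap_ne_zero_of_notMem ht2
  refine ⟨j - i, hx.congr hPp (a := s * r * u') (b := r' * u)
    (by simp [hPp.mul_mem_iff_mem_or_mem, hs, hr, hu'])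
    (by simp [hPp.mul_mem_iff_mem_or_mem, hr', hu]) ?_⟩
  have hcu' := congrArg (algebraMap D K) hcu
  have hau' := congrArg (algebraMap D K) hau
  simp only [map_mul, map_pow] at hcu' hau' ⊢
  rw [zpow_sub₀ ht0, zpow_natCast, zpow_natCast, mul_div_assoc', div_eq_iff (pow_ne_zero i ht0)]
  linear_combination (algebraMap D K r * algebraMap D K r') * hc -
    algebraMap D K s * algebraMap D K r * hau' + algebraMap D K r' * x * hcu'

/-- At `P ∈ X` an ideal of `Inv_X(D)` is `t ^ n D_P` with `t` a uniformizer; it contains `Q D_P`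
because `Q` lies in all powers of `P`, lies in `D_Q` because `t ∉ Q`, and both inclusions are strict
as `t ^ n ∉ Q D_P` and `t ^ (n - 1) ∉ t ^ n D_P`. -/
theorem isEvaluableOn_of_mem_InvOn (hX : IsDiscreteSplittingSet X)
    (hmax : ∀ P ∈ X, P.asIdeal.IsMaximal) {I : FractionalIdeal D⁰ K} (hI : I ∈ InvOn K X) :
    IsEvaluableOn I X := by
  intro P hP
  have hPm := hmax P hP
  have hPp := P.2
  have hQ := powInf_isPrime (hX.not_idempotent P hP)
  have hQP : powInf P.asIdeal ≤ P.asIdeal := by simpa using powInf_le P.asIdeal 1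
  obtain ⟨t, ht, ht2⟩ := hX.exists_mem_notMem_sq hP
  have htQ : t ∉ powInf P.asIdeal := fun h => ht2 (powInf_le _ 2 h)
  have ht0 : algebraMap D K t ≠ 0 := algebraMap_ne_zero_of_notMem ht2
  have hinj := FaithfulSMul.algebraMap_injective D K
  have hpowQ : ∀ m : ℕ, t ^ m ∉ powInf P.asIdeal := fun m h => htQ (hQ.mem_of_pow_mem m h)
  obtain ⟨n, s, hs, hsI, h⟩ := exists_zpow_isLocalGenerator hX hmax hI hP ht ht2
  have hsQ : s ∉ powInf P.asIdeal := fun h => hs (hQP h)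
  have hn : algebraMap D K t ^ n * algebraMap D K t ^ (-n).toNat =
      algebraMap D K t ^ n.toNat := by
    rw [← zpow_natCast, ← zpow_natCast, ← zpow_add₀ ht0]
    congr 1
    omega
  refine ⟨hQ, ⟨fun x hx => ?_, fun hle => ?_⟩, ⟨fun x hx => ?_, fun hle => ?_⟩⟩
  · obtain ⟨r, hr, hx⟩ := mem_extendAt_iff.1 hx
    obtain ⟨q, hq, hqx⟩ := (FractionalIdeal.mem_coeIdeal _).1 hx
    obtain ⟨r', hr', c, hc⟩ := exists_mul_eq_mul_pow hPm ht2 n.toNat (powInf_le _ _ hq)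
    refine mem_extendAt_iff.2 ⟨s * r * r', by simp [hPp.mul_mem_iff_mem_or_mem, hs, hr, hr'], ?_⟩
    have : algebraMap D K (s * r * r') * x =
        (c * t ^ (-n).toNat) • (algebraMap D K s * algebraMap D K t ^ n) := by
      have hc' := congrArg (algebraMap D K) hc
      simp only [Algebra.smul_def, map_mul, map_pow] at hc' ⊢
      linear_combination -algebraMap D K s * algebraMap D K r' * hqx + algebraMap D K s * hc' -
        algebraMap D K s * algebraMap D K c * hn
    rw [this]
    exact Submodule.smul_mem (I : Submodule D K) _ hsI
  · obtain ⟨r, hr, hx⟩ := mem_extendAt_iff.1 (hle (mem_extendAt_iff.2 ⟨s, hs, hsI⟩))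
    obtain ⟨q, hq, hqx⟩ := (FractionalIdeal.mem_coeIdeal _).1 hx
    have : r * t ^ n.toNat = q * t ^ (-n).toNat := hinj (by
      simp only [map_mul, map_pow]
      linear_combination -algebraMap D K r * hn - algebraMap D K t ^ (-n).toNat * hqx)
    have hmem := this.symm ▸ Ideal.mul_mem_right (t ^ (-n).toNat) _ hq
    exact (hQ.mem_or_mem hmem).elim (fun h => hr (hQP h)) (hpowQ _)
  · obtain ⟨r, hr, hx⟩ := mem_extendAt_iff.1 hx
    obtain ⟨c, hc⟩ := h _ hx
    refine (Subalgebra.mem_toSubmodule _).2 (mem_localizationIn_iff.2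
      ⟨s * r * t ^ (-n).toNat, ?_, c * t ^ n.toNat, ?_⟩)
    · have hrQ : r ∉ powInf P.asIdeal := fun h => hr (hQP h)
      simp [hQ.mul_mem_iff_mem_or_mem, hsQ, hrQ, hpowQ]
    · simp only [map_mul, map_pow]
      linear_combination algebraMap D K t ^ (-n).toNat * hc + algebraMap D K c * hn
  · have hmem : algebraMap D K t ^ (n - 1) ∈ localizationIn K (powInf P.asIdeal) := by
      refine mem_localizationIn_iff.2 ⟨t ^ (1 - n).toNat, hpowQ _, t ^ (n - 1).toNat, ?_⟩
      rw [map_pow, map_pow, ← zpow_natCast, ← zpow_natCast, ← zpow_add₀ ht0]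
      congr 1
      omega
    obtain ⟨r, hr, hx⟩ := mem_extendAt_iff.1 (hle ((Subalgebra.mem_toSubmodule _).2 hmem))
    obtain ⟨c, hc⟩ := h _ hx
    have : s * r = c * t := by
      refine hinj (mul_right_cancel₀ (zpow_ne_zero (n - 1) ht0) ?_)
      rw [map_mul, map_mul, mul_assoc, hc, mul_assoc, ← zpow_one_add₀ ht0, add_sub_cancel]
    exact (hPp.mem_or_mem (this ▸ Ideal.mul_mem_left _ c ht)).elim hs hr

end Evaluability

/-! ### Continuity of the ideal function -/

section IdealFunction

variable {D : Type*} [CommRing D] [IsDomain D] [IsPruferDomain D]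
variable {K : Type*} [Field K] [Algebra D K] [IsFractionRing D K]
variable {X : Set (PrimeSpectrum D)}

theorem IsLocalGenerator.idealFunction_eq (hX : IsDiscreteSplittingSet X)
    (hmax : ∀ P ∈ X, P.asIdeal.IsMaximal) {I : FractionalIdeal D⁰ K} (P : X) {t : D}
    (ht : t ∈ P.1.asIdeal) (ht2 : t ∉ P.1.asIdeal ^ 2) {n : ℤ}
    (h : IsLocalGenerator I P.1.asIdeal (algebraMap D K t ^ n)) :
    idealFunction hX hmax I P = n :=
  have := hmax P.1 P.2
  h.localValue_eq (hX.not_idempotent P.1 P.2) ht ht2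

/-- Around a point with a local uniformizer, the ideal function of every `I ∈ Inv_X(D)` is
constant. -/
theorem HasLocalUniformizer.idealFunction_eventually_eq (hX : IsDiscreteSplittingSet X)
    (hmax : ∀ P ∈ X, P.asIdeal.IsMaximal) {I : FractionalIdeal D⁰ K} (hI : I ∈ InvOn K X) (M : X)
    (h : HasLocalUniformizer X M.1) :
    ∃ F : Ideal D, F.FG ∧ F ≤ M.1.asIdeal ∧
      ∀ P : X, F ≤ P.1.asIdeal → idealFunction hX hmax I P = idealFunction hX hmax I M := by
  obtain ⟨F, hF, hFM, t, ht, ht2⟩ := h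
  obtain ⟨n, hn⟩ := exists_zpow_isLocalGenerator hX hmax hI M.2 (hFM ht) (ht2 M.1 M.2 hFM)
  obtain ⟨C, hC, hCM, hCP⟩ := hn.exists_fg (hmax M.1 M.2)
  refine ⟨F ⊔ C, Submodule.FG.sup hF hC, sup_le hFM hCM, fun P hP => ?_⟩
  rw [hn.idealFunction_eq hX hmax M (hFM ht) (ht2 M.1 M.2 hFM)]
  have hFP : F ≤ P.1.asIdeal := le_sup_left.trans hP
  exact (hCP P.1 (le_sup_right.trans hP)).idealFunction_eq hX hmax P (hFP ht) (ht2 P.1 P.2 hFP)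

theorem inverseContinuous_idealFunction_coeIdeal (hX : IsDiscreteSplittingSet X)
    (hmax : ∀ P ∈ X, P.asIdeal.IsMaximal) {I : Ideal D}
    (hI : (I : FractionalIdeal D⁰ K) ∈ InvOn K X)
    (h : ∀ M : PrimeSpectrum D, I ≤ M.asIdeal → HasLocalUniformizer X M) :
    InverseContinuous (idealFunction hX hmax (I : FractionalIdeal D⁰ K)) := by
  refine inverseContinuous_iff.2 fun M => ?_
  by_cases hIM : I ≤ M.1.asIdeal
  · exact (h M.1 hIM).idealFunction_eventually_eq hX hmax hI M
  -- Off `V(I)` the function vanishes, and `V(I)` is closed in `X` because `X` consists of maximal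
  -- ideals.
  have hzero : ∀ P : X, ¬ I ≤ P.1.asIdeal →
      idealFunction hX hmax (I : FractionalIdeal D⁰ K) P = 0 := fun P hP => by
    obtain ⟨t, ht, ht2⟩ := hX.exists_mem_notMem_sq P.2
    exact IsLocalGenerator.idealFunction_eq hX hmax P ht ht2
      (by simpa using isLocalGenerator_one hP)
  obtain ⟨s, hsI, hs⟩ := SetLike.not_le_iff_exists.1 hIM
  obtain ⟨r, hr⟩ := (hmax M.1 M.2).exists_one_sub_mul_mem hs
  refine ⟨Ideal.span {1 - r * s}, Submodule.fg_span_singleton _,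
    (Ideal.span_singleton_le_iff_mem _).2 hr, fun P hP => ?_⟩
  rw [hzero M hIM, hzero P fun hle => P.1.2.notMem_of_one_sub_mul_mem
    ((Ideal.span_singleton_le_iff_mem _).1 hP) (hle hsI)]

/-- If `ν_I` is continuous at `M ⊇ I`, then an element of `M` outside `M ^ 2` is a local uniformizer
at `M`: near `M` one has `I D_P = t ^ n D_P` with `n = ν_I(P) > 0`, so `t` has value `1` at `P`. -/
theorem hasLocalUniformizer_of_inverseContinuous (hX : IsDiscreteSplittingSet X)
    (hmax : ∀ P ∈ X, P.asIdeal.IsMaximal) {I : Ideal D}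
    (hI : (I : FractionalIdeal D⁰ K) ∈ InvOn K X)
    (h : InverseContinuous (idealFunction hX hmax (I : FractionalIdeal D⁰ K)))
    {M : PrimeSpectrum D} (hM : M ∈ X) (hIM : I ≤ M.asIdeal) : HasLocalUniformizer X M := by
  obtain ⟨F, hF, hFM, hFP⟩ := inverseContinuous_iff.1 h ⟨M, hM⟩
  obtain ⟨t, ht, ht2⟩ := hX.exists_mem_notMem_sq hM
  obtain ⟨n, hn⟩ := exists_zpow_isLocalGenerator hX hmax hI hM ht ht2
  have hn1 : 1 ≤ n := by
    exact_mod_cast hn.le_of_le_pow (hmax M hM) ht ht2 (k := 1) (by simpa using hIM)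
  obtain ⟨C, hC, hCM, hCP⟩ := hn.exists_fg (hmax M hM)
  refine ⟨F ⊔ C ⊔ Ideal.span {t},
    Submodule.FG.sup (Submodule.FG.sup hF hC) (Submodule.fg_span_singleton _),
    sup_le (sup_le hFM hCM) ((Ideal.span_singleton_le_iff_mem _).2 ht), t,
    Ideal.mem_sup_right (Ideal.mem_span_singleton_self t), fun P hP hle htP => ?_⟩
  have heq := hFP ⟨P, hP⟩ ((le_sup_left.trans le_sup_left).trans hle)
  rw [hn.idealFunction_eq hX hmax ⟨M, hM⟩ ht ht2] at heq
  obtain ⟨t', ht', ht2'⟩ := hX.exists_mem_notMem_sq hP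
  obtain ⟨m, hm⟩ := exists_zpow_isLocalGenerator hX hmax hI hP ht' ht2'
  rw [hm.idealFunction_eq hX hmax ⟨P, hP⟩ ht' ht2'] at heq
  subst heq
  have hmP := hCP P ((le_sup_right.trans le_sup_left).trans hle)
  lift m to ℕ using by omega
  rw [zpow_natCast] at hmP
  have := hm.le_of_le_pow (hmax P hP) ht' ht2' (hmP.le_pow (hmax P hP) htP)
  push_cast at this
  omega

end IdealFunction

/-! ### Critical ideals, radical factorizations and continuity -/

theorem mainTheorem3 {D : Type*} [CommRing D] [IsDomain D] [IsPruferDomain D]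
    (K : Type*) [Field K] [Algebra D K] [IsFractionRing D K]
    (X : Set (PrimeSpectrum D)) (hX : IsDiscreteSplittingSet X)
    (hmax : ∀ P ∈ X, P.asIdeal.IsMaximal) :
    (∀ I ∈ InvOn K X, IsEvaluableOn I X) ∧
    (∀ I : Ideal D, I ≠ ⊤ → (I : FractionalIdeal D⁰ K) ∈ InvOn K X →
      List.TFAE [
        PrimeSpectrum.zeroLocus (I : Set D) ∩ criticalSet K X = ∅,
        I.radical.FG,
        HasRadicalFactorization I,
        InverseContinuous (idealFunction hX hmax (I : FractionalIdeal D⁰ K))]) ∧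
    List.TFAE [
      criticalSet K X = ∅,
      ∀ I : Ideal D, I ≠ ⊤ → (I : FractionalIdeal D⁰ K) ∈ InvOn K X → I.radical.FG,
      ∀ I : Ideal D, I ≠ ⊤ → (I : FractionalIdeal D⁰ K) ∈ InvOn K X →
        HasRadicalFactorization I,
      ∀ I ∈ InvOn K X, InverseContinuous (idealFunction hX hmax I)] := by
  have hlocal : ∀ I : Ideal D, I ≠ ⊤ → (I : FractionalIdeal D⁰ K) ∈ InvOn K X →
      List.TFAE [
        PrimeSpectrum.zeroLocus (I : Set D) ∩ criticalSet K X = ∅,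
        I.radical.FG,
        HasRadicalFactorization I,
        InverseContinuous (idealFunction hX hmax (I : FractionalIdeal D⁰ K))] := by
    intro I _ hI
    obtain ⟨hfg, -, hIX⟩ := coeIdeal_mem_InvOn_iff.1 hI
    have hcrit : PrimeSpectrum.zeroLocus (I : Set D) ∩ criticalSet K X = ∅ ↔
        ∀ M : PrimeSpectrum D, I ≤ M.asIdeal → HasLocalUniformizer X M := by
      rw [← Set.disjoint_iff_inter_eq_empty, Set.disjoint_left]
      exact forall₂_congr fun M hM => notMem_criticalSet_iff K hX hmax (hIX M hM)
    rw [hcrit]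
    tfae_have 1 → 2 := radical_fg_of_hasLocalUniformizer hmax hfg hIX
    tfae_have 2 → 1 := fun hR M hM =>
      hasLocalUniformizer_of_isRadical hX hmax I.radical_isRadical hR
        (fun P hP => hIX P (Ideal.le_radical.trans hP)) (M.2.radical_le_iff.2 hM)
    tfae_have 1 → 3 := fun h =>
      have ⟨n, hn⟩ := exists_forall_not_le_pow hX hmax hIX
        (radical_fg_of_hasLocalUniformizer hmax hfg hIX h)
      hasRadicalFactorization_of_hasLocalUniformizer hX hmax n hfg hIX h hn
    tfae_have 3 → 1 := fun h M hM =>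
      have ⟨J, hJ, hJr, hIJ, hJM⟩ := exists_isRadical_of_hasRadicalFactorization h M.2 hM
      hasLocalUniformizer_of_isRadical hX hmax hJr hJ (fun P hP => hIX P (hIJ.trans hP)) hJM
    tfae_have 1 → 4 := inverseContinuous_idealFunction_coeIdeal hX hmax hI
    tfae_have 4 → 1 := fun h M hM =>
      hasLocalUniformizer_of_inverseContinuous hX hmax hI h (hIX M hM) hM
    tfae_finish
  refine ⟨fun I hI => isEvaluableOn_of_mem_InvOn hX hmax hI, hlocal, ?_⟩
  -- `V(A) ⊆ X` for some finitely generated `A ≤ M`, whence the conditions on the proper ideals of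
  -- `Inv_X(D)`, applied to `A`, control the point `M`.
  have hempty : (∀ I : Ideal D, I ≠ ⊤ → (I : FractionalIdeal D⁰ K) ∈ InvOn K X →
      PrimeSpectrum.zeroLocus (I : Set D) ∩ criticalSet K X = ∅) → criticalSet K X = ∅ := by
    intro h
    refine Set.eq_empty_iff_forall_notMem.2 fun M hM => ?_
    obtain ⟨A, hA, hAM, hAX⟩ := hX.exists_fg_le hM.1
    have := h A (ne_top_of_le_ne_top M.2.ne_top hAM)
      (coeIdeal_mem_InvOn_iff.2 ⟨hA, hX.ne_bot hAX, hAX⟩)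
    exact Set.eq_empty_iff_forall_notMem.1 this M ⟨hAM, hM⟩
  tfae_have 1 → 2 := fun h I hne hI => ((hlocal I hne hI).out 0 1).1 (by rw [h, Set.inter_empty])
  tfae_have 2 → 1 := fun h => hempty fun I hne hI => ((hlocal I hne hI).out 0 1).2 (h I hne hI)
  tfae_have 1 → 3 := fun h I hne hI => ((hlocal I hne hI).out 0 2).1 (by rw [h, Set.inter_empty])
  tfae_have 3 → 1 := fun h => hempty fun I hne hI => ((hlocal I hne hI).out 0 2).2 (h I hne hI)
  tfae_have 1 → 4 := fun h I hI => inverseContinuous_iff.2 fun M =>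
    ((notMem_criticalSet_iff K hX hmax M.2).1 (by simp [h])).idealFunction_eventually_eq
      hX hmax hI M
  tfae_have 4 → 1 := fun h => hempty fun I hne hI => ((hlocal I hne hI).out 0 3).2 (h _ hI)
  tfae_finish
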